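/- **Setting.** Let $G\subset GL(n,\mathbb R)$ be a real reductive linear Lie group, realized as a closed subgroup stable under transpose with Cartan decomposition $G=K\exp\mathfrak p$, where $K=G\cap O(n)$. Let $G'\subset G$ be a closed real reductive subgroup (some conjugate of $G'$ in $GL(n,\mathbb R)$ is of the same form) such that $K'=K\cap G'$ is a maximal compact subgroup of $G'$. Write $\mathfrak g,\mathfrak g'$ for the Lie algebras, let $\mathfrak j\subset\mathfrak g$ and $\mathfrak j'\subset\mathfrak g'$ be Cartan subalgebras, and put $Z_G=U(\mathfrak g_{\mathbb C})^{\mathrm{Ad}(G)}$, $Z_{G'}=U(\mathfrak g'_{\mathbb C})^{\mathrm{Ad}(G')}$. For $\lambda\in\mathfrak j_{\mathbb C}^\vee$ let $\chi_\lambda:Z_G\to\mathbb C$ be the character given by the Harish-Chandra isomorphism, normalized so that the trivial representation has the parameter $\rho_{\mathfrak g}$: $\chi_\lambda(u)=\langle\gamma'(u),\lambda-\rho_{\mathfrak g}\rangle$, where $\gamma'(u)$ is the $U(\mathfrak j_{\mathbb C})$-component of $u$ in $(\mathfrak n^-U(\mathfrak g_{\mathbb C})+U(\mathfrak g_{\mathbb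 C})\mathfrak n^+)\oplus U(\mathfrak j_{\mathbb C})$. Define $\chi_\nu:Z_{G'}\to\mathbb C$ for $\nu\in(\mathfrak j'_{\mathbb C})^\vee$ likewise. For $f\in C^\infty(G)$ let $(L_Xf)(g)=\frac{d}{dt}\big|_{0}f(\exp(-tX)g)$ and $(R_Xf)(g)=\frac{d}{dt}\big|_{0}f(g\exp(tX))$ for $X\in\mathfrak g$, extended to $U(\mathfrak g_{\mathbb C})$. Let $\operatorname{Sh}(\lambda,\nu)$ be the space of $f\in C^\infty(G)$ with $f(k'gk)=f(g)$ for $k'\in K'$, $k\in K$, with $R_uf=\chi_\lambda(u)f$ for $u\in Z_G$, and with $L_vf=\chi_\nu(v)f$ for $v\in Z_{G'}$. Let $C^\infty_{\mathrm{mod}}(G)$ be the space of $f\in C^\infty(G)$ that are right $K$-finite and $Z_G$-finite and for which there is $d\in\mathbb R$ such that for every $u\in U(\mathfrak g_{\mathbb C})$ there is $C$ with $|(R_uf)(x)|\le C\|x\|^d$ for all $x\in G$, where $\|x\|=\|x\oplus{}^tx^{-1}\|_{\mathrm{op}}$. Put $\operatorname{Sh}_{\mathrm{mod}}(\lambda,\nu)=\operatorname{Sh}(\lambda,\nu)\cap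 C^\infty_{\mathrm{mod}}(G)$. An admissible smooth representation is the representation $\pi^\infty$ on the space $H^\infty$ of smooth vectors of a continuous representation $\pi$ on a Banach space $H$ that has finite length and finite $K$-multiplicities; $H^\infty$ is topologized by the seminorms $v\mapsto\|d\pi(u)v\|$, $u\in U(\mathfrak g_{\mathbb C})$. It has infinitesimal character $\lambda$ if every $u\in Z_G$ acts on $H^\infty$ by $\chi_\lambda(u)$. Let $\pi_K$ be the $(\mathfrak g,K)$-module of $K$-finite vectors, and let $\pi_K^\vee$ be its contragredient, realized as the space of $K$-finite continuous linear forms on $H^\infty$. A vector $v$ of such a module is cyclic if $U(\mathfrak g_{\mathbb C})v$ is the whole module. The same terminology is used for $G'$ and $K'$. Let $\operatorname{Hom}_{G'}(\pi^\infty,\tau^\infty)$ be the space of continuous $G'$-homomorphisms. **Proposition.** Let $\pi^\infty$ and $\tau^\infty$ be spherical admissible smooth representations of $G$ and $G'$ with infinitesimal characters $\lambda$ and $-\nu$, respectively. Let $\mathbf 1_\pi\in\pi_K$ and $\mathbf 1_{\tau^\vee}\in\tau_{K'}^\vee$ be non-zero vectors fixed by $K$ and $K'$, respectively. 1) There is a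 linear map $$\operatorname{Hom}_{G'}(\pi^\infty,\tau^\infty)\to\operatorname{Sh}_{\mathrm{mod}}(\lambda,\nu),\qquad T\mapsto F,\qquad F(g)=\langle T\circ\pi^\infty(g)\mathbf 1_\pi,\mathbf 1_{\tau^\vee}\rangle\quad(g\in G).$$ 2) If $\mathbf 1_\pi$ is cyclic in $\pi_K$ and $\mathbf 1_{\tau^\vee}$ is cyclic in $\tau_{K'}^\vee$, this map is injective. It is also injective if both $\pi^\infty$ and $\tau^\infty$ are irreducible (no closed invariant subspaces other than $0$ and the whole non-zero space). -/

import Mathlib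

open scoped TensorProduct ContDiff Matrix Topology Matrix.Norms.L2Operator

attribute [local instance] LieRing.ofAssociativeRing

namespace Shintani

section Trotter

theorem norm_pow_le_of {𝔸 : Type*} [NormedRing 𝔸] (h1 : ‖(1 : 𝔸)‖ ≤ 1) {a : 𝔸} {M : ℝ} (ha : ‖a‖ ≤ M) (k : ℕ) :
    ‖a ^ k‖ ≤ M ^ k := by
  induction k with
  | zero => simpa using h1
  | succ k ih =>
    rw [pow_succ, pow_succ]
    exact (norm_mul_le _ _).trans
      (mul_le_mul ih ha (norm_nonneg _) ((norm_nonneg _).trans ih))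

theorem norm_pow_sub_pow_le_of {𝔸 : Type*} [NormedRing 𝔸] (h1 : ‖(1 : 𝔸)‖ ≤ 1) {a b : 𝔸} {M : ℝ} (hM : 1 ≤ M)
    (ha : ‖a‖ ≤ M) (hb : ‖b‖ ≤ M) (k : ℕ) :
    ‖a ^ k - b ^ k‖ ≤ M ^ k * (k * ‖a - b‖) := by
  induction k with
  | zero => simp
  | succ k ih =>
    have e : a ^ (k + 1) - b ^ (k + 1) = a ^ k * (a - b) + (a ^ k - b ^ k) * b := by
      rw [pow_succ, pow_succ]; noncomm_ring
    have hMk : 0 ≤ M ^ k := by positivity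
    calc ‖a ^ (k + 1) - b ^ (k + 1)‖
        ≤ ‖a ^ k‖ * ‖a - b‖ + ‖a ^ k - b ^ k‖ * ‖b‖ := by
          rw [e]; exact (norm_add_le _ _).trans (add_le_add (norm_mul_le _ _) (norm_mul_le _ _))
      _ ≤ M ^ k * ‖a - b‖ + M ^ k * (k * ‖a - b‖) * M := by
          gcongr
          exact norm_pow_le_of h1 ha k
      _ ≤ M ^ k * ‖a - b‖ * M + M ^ k * (k * ‖a - b‖) * M := by
          have : M ^ k * ‖a - b‖ ≤ M ^ k * ‖a - b‖ * M :=
            le_mul_of_one_le_right (by positivity) hM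
          linarith
      _ = M ^ (k + 1) * ((k + 1 : ℕ) * ‖a - b‖) := by push_cast; ring

variable {𝔸 : Type*} [NormedRing 𝔸] [NormedAlgebra ℝ 𝔸] [CompleteSpace 𝔸]

theorem hasDerivAt_exp_smul_zero (X : 𝔸) :
    HasDerivAt (fun t : ℝ => NormedSpace.exp (t • X)) X 0 := by
  simpa using hasDerivAt_exp_smul_const (𝕂 := ℝ) X (0 : ℝ)

/-- If `γ` is a curve through `1` with velocity `X`, then `γ(1/k)^k → exp X`. -/
theorem tendsto_curve_pow (h1 : ‖(1 : 𝔸)‖ ≤ 1) {γ : ℝ → 𝔸} {X : 𝔸} (h0 : γ 0 = 1)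
    (hγ : HasDerivAt γ X 0) :
    Filter.Tendsto (fun k : ℕ => γ (1 / ((k : ℝ) + 1)) ^ (k + 1)) Filter.atTop
      (𝓝 (NormedSpace.exp X)) := by
  have hs : Filter.Tendsto (fun k : ℕ => 1 / ((k : ℝ) + 1)) Filter.atTop (𝓝 0) :=
    tendsto_one_div_add_atTop_nhds_zero_nat
  have hβ := hasDerivAt_exp_smul_zero X
  have bound : ∀ {δ : ℝ → 𝔸}, δ 0 = 1 → HasDerivAt δ X 0 →
      ∀ᶠ s in 𝓝 (0 : ℝ), ‖δ s‖ ≤ 1 + (‖X‖ + 1) * |s| := by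
    intro δ hδ0 hδ
    have := (hasDerivAt_iff_isLittleO.1 hδ).bound (one_pos)
    filter_upwards [this] with s hs
    have e : δ s = 1 + s • X + (δ s - δ 0 - (s - 0) • X) := by rw [hδ0]; simp
    calc ‖δ s‖ ≤ ‖(1 : 𝔸)‖ + ‖s • X‖ + ‖δ s - δ 0 - (s - 0) • X‖ := by
          conv_lhs => rw [e]
          exact norm_add₃_le
      _ ≤ 1 + |s| * ‖X‖ + 1 * ‖s - 0‖ := by
          gcongr
          rw [norm_smul, Real.norm_eq_abs]
      _ = _ := by rw [sub_zero, Real.norm_eq_abs]; ring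
  have hb1 := hs.eventually (bound h0 hγ)
  have hb2 := hs.eventually (bound (by simp) hβ)
  have hlo : Filter.Tendsto (fun k : ℕ => ((k : ℝ) + 1) *
      ‖γ (1 / ((k : ℝ) + 1)) - NormedSpace.exp ((1 / ((k : ℝ) + 1)) • X)‖) Filter.atTop (𝓝 0) := by
    have h := hγ.sub hβ
    rw [sub_self, hasDerivAt_iff_isLittleO] at h
    have h' := (h.comp_tendsto hs).norm_left.norm_right.tendsto_div_nhds_zero
    refine h'.congr fun k => ?_
    have : (0 : ℝ) < (k : ℝ) + 1 := by positivity
    simp only [Function.comp, Pi.sub_apply, h0, zero_smul, NormedSpace.exp_zero, sub_self,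
      sub_zero, smul_zero, Real.norm_eq_abs, abs_of_pos (one_div_pos.2 this)]
    field_simp
  set C := ‖X‖ + 1
  have hC : 0 ≤ C := by positivity
  rw [tendsto_iff_norm_sub_tendsto_zero]
  refine squeeze_zero' (Filter.Eventually.of_forall fun _ => norm_nonneg _) ?_
    (g := fun k : ℕ => Real.exp C * (((k : ℝ) + 1) *
      ‖γ (1 / ((k : ℝ) + 1)) - NormedSpace.exp ((1 / ((k : ℝ) + 1)) • X)‖))
    (by simpa using hlo.const_mul (Real.exp C))
  filter_upwards [hb1, hb2] with k h1' h2'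
  have hk : (0 : ℝ) < (k : ℝ) + 1 := by positivity
  rw [abs_of_pos (one_div_pos.2 hk)] at h1' h2'
  have e : NormedSpace.exp X = NormedSpace.exp ((1 / ((k : ℝ) + 1)) • X) ^ (k + 1) := by
    let _ : NormedAlgebra ℚ 𝔸 := NormedAlgebra.restrictScalars ℚ ℝ 𝔸
    rw [← NormedSpace.exp_nsmul, ← Nat.cast_smul_eq_nsmul ℝ, smul_smul]
    push_cast
    rw [mul_one_div_cancel hk.ne', one_smul]
  rw [e]
  refine (norm_pow_sub_pow_le_of h1 (M := 1 + C * (1 / ((k : ℝ) + 1)))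
    (by have : 0 ≤ C * (1 / ((k : ℝ) + 1)) := by positivity
        linarith) h1' h2' (k + 1)).trans ?_
  push_cast
  gcongr
  calc (1 + C * (1 / ((k : ℝ) + 1))) ^ (k + 1)
      ≤ (Real.exp (C * (1 / ((k : ℝ) + 1)))) ^ (k + 1) := by
        gcongr
        rw [add_comm]; exact Real.add_one_le_exp _
    _ = Real.exp C := by
        rw [← Real.exp_nat_mul]; congr 1; push_cast; field_simp

end Trotter

abbrev Mat (n : ℕ) := Matrix (Fin n) (Fin n) ℝ

variable {n : ℕ}

theorem norm_one_mat_le : ‖(1 : Mat n)‖ ≤ 1 := by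
  rcases isEmpty_or_nonempty (Fin n) with h | h
  · have : (1 : Mat n) = 0 := Subsingleton.elim _ _
    simp [this]
  · exact (CStarRing.norm_one).le

/-- A closed linear group. -/
abbrev LinGrp (n : ℕ) := ClosedSubgroup (GL (Fin n) ℝ)

/-- The matrix of an element of a closed linear group. -/
def mat {G : LinGrp n} (g : G) : Mat n := (g : GL (Fin n) ℝ).val

variable {G : LinGrp n}

theorem mat_mul (g h : G) : mat (g * h) = mat g * mat h := rfl
theorem mat_one : mat (1 : G) = 1 := rfl
theorem mat_mul_inv (g : G) : mat g * mat g⁻¹ = 1 := by rw [← mat_mul, mul_inv_cancel, mat_one]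
theorem mat_inv_mul (g : G) : mat g⁻¹ * mat g = 1 := by rw [← mat_mul, inv_mul_cancel, mat_one]
theorem mat_injective : Function.Injective (mat : G → Mat n) :=
  fun _ _ h => Subtype.ext (Units.ext h)
theorem isInducing_mat : Topology.IsInducing (mat : G → Mat n) :=
  Units.isOpenEmbedding_val.isInducing.comp Topology.IsInducing.subtypeVal

theorem continuous_mat : Continuous (mat : G → Mat n) := isInducing_mat.continuous

theorem exists_mat_of_tendsto {u : ℕ → G} {A : Mat n} (hA : IsUnit A)
    (h : Filter.Tendsto (fun k => mat (u k)) Filter.atTop (𝓝 A)) : ∃ g : G, mat g = A := by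
  obtain ⟨a, rfl⟩ := hA
  have h' : Filter.Tendsto (fun k => (u k : GL (Fin n) ℝ)) Filter.atTop (𝓝 a) :=
    (Units.isOpenEmbedding_val.isInducing.tendsto_nhds_iff).2 h
  exact ⟨⟨a, G.isClosed'.mem_of_tendsto h' (Filter.Eventually.of_forall fun k => (u k).2)⟩, rfl⟩

theorem isUnit_exp_mat (X : Mat n) : IsUnit (NormedSpace.exp X) := Matrix.isUnit_exp X

/-- The velocity of a curve in `G` through the identity generates a one-parameter subgroup
of `G`. -/
theorem exp_mem_of_curve {γ : ℝ → G} {X : Mat n} (h0 : γ 0 = 1)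
    (hγ : HasDerivAt (fun t => mat (γ t)) X 0) (t : ℝ) :
    ∃ g : G, mat g = NormedSpace.exp (t • X) := by
  have h : HasDerivAt (fun s => mat (γ (t * s))) (t • X) 0 := by
    have := HasDerivAt.scomp (g₁ := fun t => mat (γ t)) (h := fun s : ℝ => t * s) (g₁' := X) (h' := t) (0 : ℝ)
      (by simpa using hγ) (by simpa using (hasDerivAt_id (0 : ℝ)).const_mul t)
    exact this
  have := tendsto_curve_pow norm_one_mat_le (by simp [h0, mat_one]) h
  have hp : ∀ (g : G) (k : ℕ), mat (g ^ k) = mat g ^ k := fun g k => by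
    induction k with
    | zero => simp [mat_one]
    | succ k ih => rw [pow_succ, pow_succ, mat_mul, ih]
  exact exists_mat_of_tendsto (u := fun k : ℕ => γ (t * (1 / ((k : ℝ) + 1))) ^ (k + 1))
    (isUnit_exp_mat _) (by simpa only [hp] using this)

/-- The set `{X : exp (tX) ∈ G for all t ∈ ℝ}`. -/
def expSet (G : LinGrp n) : Set (Mat n) := {X | ∀ t : ℝ, ∃ g : G, mat g = NormedSpace.exp (t • X)}

theorem conj_mem_expSet (g : G) {X : Mat n} (hX : X ∈ expSet G) :
    mat g * X * mat g⁻¹ ∈ expSet G := fun t => by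
  obtain ⟨h, hh⟩ := hX t
  refine ⟨g * h * g⁻¹, ?_⟩
  rw [mat_mul, mat_mul, hh]
  let _ : NormedAlgebra ℚ (Mat n) := NormedAlgebra.restrictScalars ℚ ℝ (Mat n)
  have := NormedSpace.exp_units_conj ((g : GL (Fin n) ℝ)) (t • X)
  rw [show t • (mat g * X * mat g⁻¹) = mat g * (t • X) * mat g⁻¹ by simp]
  exact this.symm

/-- The one-parameter subgroup of `G` generated by an element of its Lie algebra. -/
noncomputable def oneParam {X : Mat n} (hX : X ∈ expSet G) (t : ℝ) : G := (hX t).choose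

theorem mat_oneParam {X : Mat n} (hX : X ∈ expSet G) (t : ℝ) :
    mat (oneParam hX t) = NormedSpace.exp (t • X) := (hX t).choose_spec

theorem oneParam_zero {X : Mat n} (hX : X ∈ expSet G) : oneParam hX 0 = 1 :=
  mat_injective (by rw [mat_oneParam, mat_one]; simp)

theorem hasDerivAt_mat_oneParam {X : Mat n} (hX : X ∈ expSet G) :
    HasDerivAt (fun t => mat (oneParam hX t)) X 0 := by
  simp only [mat_oneParam]; exact hasDerivAt_exp_smul_zero X

theorem continuous_oneParam {X : Mat n} (hX : X ∈ expSet G) : Continuous (oneParam hX) := by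
  rw [isInducing_mat.continuous_iff]
  have : mat ∘ oneParam hX = fun t : ℝ => NormedSpace.exp (t • X) :=
    funext fun t => mat_oneParam hX t
  rw [this]
  let _ : NormedAlgebra ℚ (Mat n) := NormedAlgebra.restrictScalars ℚ ℝ (Mat n)
  exact NormedSpace.exp_continuous.comp (continuous_id.smul continuous_const)

/-- The linear space underlying the Lie algebra. -/
def lieSubmodule (G : LinGrp n) : Submodule ℝ (Mat n) where
  carrier := expSet G
  zero_mem' t := ⟨1, by simp [mat_one]⟩
  smul_mem' c X hX t := by
    obtain ⟨g, hg⟩ := hX (t * c)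
    exact ⟨g, by rw [hg, smul_smul]⟩
  add_mem' {X Y} hX hY := by
    refine exp_mem_of_curve (γ := fun t => oneParam hX t * oneParam hY t)
      (by simp [oneParam_zero]) ?_
    simp only [mat_mul]
    have := (hasDerivAt_mat_oneParam hX).mul (hasDerivAt_mat_oneParam hY)
    simp only [oneParam_zero, mat_one, mul_one, one_mul] at this
    exact this

theorem lie_mem_lieSubmodule {X Y : Mat n} (hX : X ∈ lieSubmodule G) (hY : Y ∈ lieSubmodule G) :
    X * Y - Y * X ∈ lieSubmodule G := by
  have hX' : X ∈ expSet G := hX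
  have hXn : -X ∈ expSet G := (lieSubmodule G).neg_mem hX
  have hinv : ∀ t, mat (oneParam hX' t)⁻¹ = NormedSpace.exp (t • (-X)) := fun t => by
    have h1 : NormedSpace.exp (t • (-X)) * mat (oneParam hX' t) = 1 := by
      rw [mat_oneParam, smul_neg]
      let _ : NormedAlgebra ℚ (Mat n) := NormedAlgebra.restrictScalars ℚ ℝ (Mat n)
      rw [← NormedSpace.exp_add_of_commute (Commute.refl (t • X)).neg_left]
      simp
    calc mat (oneParam hX' t)⁻¹
        = NormedSpace.exp (t • (-X)) * mat (oneParam hX' t) * mat (oneParam hX' t)⁻¹ := by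
          rw [h1, one_mul]
      _ = _ := by rw [mul_assoc, mat_mul_inv, mul_one]
  have hd : HasDerivAt (fun t : ℝ => mat (oneParam hX' t) * Y * mat (oneParam hX' t)⁻¹)
      (X * Y - Y * X) 0 := by
    simp only [hinv]
    have := ((hasDerivAt_mat_oneParam hX').mul_const Y).mul (hasDerivAt_exp_smul_zero (-X))
    simp only [oneParam_zero, mat_one, mul_one, one_mul, zero_smul, NormedSpace.exp_zero,
      mul_neg, ← sub_eq_add_neg] at this
    exact this
  have hcl : IsClosed (lieSubmodule G : Set (Mat n)) := (lieSubmodule G).closed_of_finiteDimensional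
  refine hcl.mem_of_tendsto (hasDerivAt_iff_tendsto_slope.1 hd) ?_
  refine Filter.Eventually.of_forall fun t => ?_
  rw [slope_def_module]
  exact (lieSubmodule G).smul_mem _ ((lieSubmodule G).sub_mem
    (conj_mem_expSet _ hY) (conj_mem_expSet _ hY))

/-- The Lie algebra `{X : exp (tX) ∈ G for all t ∈ ℝ}` of a closed linear group, with the
commutator bracket. -/
def lieAlg (G : LinGrp n) : LieSubalgebra ℝ (Mat n) :=
  { lieSubmodule G with lie_mem' := fun hX hY => lie_mem_lieSubmodule hX hY }


/-! ### Smooth functions and invariant differentiation -/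

theorem mem_lieAlg {X : Mat n} :
    X ∈ lieAlg G ↔ ∀ t : ℝ, ∃ g : G, mat g = NormedSpace.exp (t • X) := Iff.rfl

theorem coe_mem_expSet (X : lieAlg G) : (X : Mat n) ∈ expSet G := X.2

instance : IsTopologicalGroup G := inferInstanceAs (IsTopologicalGroup G.toSubgroup)

/-- The exponential map of `G`. -/
noncomputable def expG (X : lieAlg G) : G := oneParam (coe_mem_expSet X) 1

theorem mat_expG (X : lieAlg G) : mat (expG X) = NormedSpace.exp (X : Mat n) := by
  rw [expG, mat_oneParam, one_smul]

theorem expG_smul (X : lieAlg G) (t : ℝ) : expG (t • X) = oneParam (coe_mem_expSet X) t :=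
  mat_injective (by rw [mat_expG, mat_oneParam]; rfl)

variable {E : Type*} [NormedAddCommGroup E] [NormedSpace ℂ E]

/-- A map `f` on a closed linear group is smooth if near each point it is the restriction of a
smooth map defined on matrices. -/
def IsSmooth (f : G → E) : Prop :=
  ∀ g : G, ∃ F : Mat n → E, ContDiffAt ℝ ∞ F (mat g) ∧ ∀ᶠ h in 𝓝 g, f h = F (mat h)

/-- The space `C^∞(G, E)`. -/
def SmoothFn (G : LinGrp n) (E : Type*) [NormedAddCommGroup E] [NormedSpace ℂ E] :
    Submodule ℂ (G → E) where
  carrier := {f | IsSmooth f}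
  zero_mem' _ := ⟨0, contDiffAt_const, Filter.Eventually.of_forall fun _ => rfl⟩
  add_mem' {f₁ f₂} h₁ h₂ g := by
    obtain ⟨F₁, hF₁, e₁⟩ := h₁ g
    obtain ⟨F₂, hF₂, e₂⟩ := h₂ g
    refine ⟨F₁ + F₂, hF₁.add hF₂, ?_⟩
    filter_upwards [e₁, e₂] with h i₁ i₂
    simp [i₁, i₂]
  smul_mem' c f hf g := by
    obtain ⟨F, hF, e⟩ := hf g
    refine ⟨c • F, hF.const_smul c, ?_⟩
    filter_upwards [e] with h i
    simp [i]

section Flow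

variable {c : ℝ → G → G} {A : Mat n →L[ℝ] Mat n}

/-- `c` is a flow on `G` (near time zero) whose velocity is the restriction of the linear vector
field `A`. -/
structure IsFlow (c : ℝ → G → G) (A : Mat n →L[ℝ] Mat n) : Prop where
  zero : ∀ h, c 0 h = h
  cont : ∀ h, Continuous fun t => c t h
  hasDeriv : ∀ h, HasDerivAt (fun t => mat (c t h)) (A (mat h)) 0

theorem IsFlow.hasDerivAt (hc : IsFlow c A) {f : G → E} {F : Mat n → E} {g : G}
    (hF : ContDiffAt ℝ ∞ F (mat g)) (hf : ∀ᶠ h in 𝓝 g, f h = F (mat h)) :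
    ∀ᶠ h in 𝓝 g, HasDerivAt (fun t => f (c t h)) (fderiv ℝ F (mat h) (A (mat h))) 0 := by
  have hd : ∀ᶠ x in 𝓝 (mat g), ContDiffAt ℝ 1 F x :=
    (hF.of_le (by norm_cast)).eventually (by simp)
  filter_upwards [hf.eventually_nhds, continuous_mat.continuousAt.eventually hd] with h h1 h2
  have hdF := (h2.differentiableAt (by simp)).hasFDerivAt
  have hcomp : HasDerivAt (fun t => F (mat (c t h))) (fderiv ℝ F (mat h) (A (mat h))) 0 := by
    refine HasFDerivAt.comp_hasDerivAt (l := F) (f := fun t => mat (c t h)) 0 ?_ (hc.hasDeriv h)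
    simpa only [hc.zero] using hdF
  refine hcomp.congr_of_eventuallyEq ?_
  have ht : Filter.Tendsto (fun t => c t h) (𝓝 0) (𝓝 h) := by
    have := (hc.cont h).tendsto 0
    rwa [hc.zero] at this
  exact ht.eventually h1

theorem contDiffAt_fderiv_apply {F : Mat n → E} {x : Mat n} (hF : ContDiffAt ℝ ∞ F x) :
    ContDiffAt ℝ ∞ (fun y => fderiv ℝ F y (A y)) x :=
  (hF.fderiv_right (m := ∞) le_rfl).clm_apply A.contDiff.contDiffAt

theorem IsFlow.deriv_eq (hc : IsFlow c A) {f : G → E} {F : Mat n → E} {g : G}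
    (hF : ContDiffAt ℝ ∞ F (mat g)) (hf : ∀ᶠ h in 𝓝 g, f h = F (mat h)) :
    ∀ᶠ h in 𝓝 g, deriv (fun t => f (c t h)) 0 = fderiv ℝ F (mat h) (A (mat h)) :=
  (hc.hasDerivAt hF hf).mono fun _ h => h.deriv

/-- Differentiation of smooth functions along a flow. -/
noncomputable def IsFlow.diff (hc : IsFlow c A) : Module.End ℂ (SmoothFn G E) where
  toFun f := ⟨fun g => deriv (fun t => (f : G → E) (c t g)) 0, fun g => by
    obtain ⟨F, hF, e⟩ := f.2 g
    exact ⟨_, contDiffAt_fderiv_apply hF, hc.deriv_eq hF e⟩⟩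
  map_add' f₁ f₂ := by
    ext g
    obtain ⟨F₁, hF₁, e₁⟩ := f₁.2 g
    obtain ⟨F₂, hF₂, e₂⟩ := f₂.2 g
    exact deriv_fun_add (hc.hasDerivAt hF₁ e₁).self_of_nhds.differentiableAt
      (hc.hasDerivAt hF₂ e₂).self_of_nhds.differentiableAt
  map_smul' a f := by
    ext g
    obtain ⟨F, hF, e⟩ := f.2 g
    exact deriv_fun_const_smul a (hc.hasDerivAt hF e).self_of_nhds.differentiableAt

theorem IsFlow.diff_apply (hc : IsFlow c A) (f : SmoothFn G E) (g : G) :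
    (hc.diff f : G → E) g = deriv (fun t => (f : G → E) (c t g)) 0 := rfl

theorem IsFlow.diff_eq (hc : IsFlow c A) (f : SmoothFn G E) {F : Mat n → E} {g : G}
    (hF : ContDiffAt ℝ ∞ F (mat g)) (hf : ∀ᶠ h in 𝓝 g, (f : G → E) h = F (mat h)) :
    (hc.diff f : G → E) g = fderiv ℝ F (mat g) (A (mat g)) :=
  (hc.deriv_eq hF hf).self_of_nhds

theorem IsFlow.diff_diff_eq {d : ℝ → G → G} {B : Mat n →L[ℝ] Mat n} (hc : IsFlow c A)
    (hd : IsFlow d B) (f : SmoothFn G E) {F : Mat n → E} {g : G}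
    (hF : ContDiffAt ℝ ∞ F (mat g)) (hf : ∀ᶠ h in 𝓝 g, (f : G → E) h = F (mat h)) :
    (hc.diff (hd.diff f) : G → E) g =
      fderiv ℝ (fderiv ℝ F) (mat g) (A (mat g)) (B (mat g)) +
        fderiv ℝ F (mat g) (B (A (mat g))) := by
  rw [hc.diff_eq (hd.diff f) (contDiffAt_fderiv_apply hF) (hd.deriv_eq hF hf)]
  have h1 : DifferentiableAt ℝ (fderiv ℝ F) (mat g) :=
    (hF.fderiv_right (m := ∞) le_rfl).differentiableAt (by simp)
  rw [fderiv_clm_apply h1 B.differentiableAt]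
  simp [add_comm]

theorem IsFlow.diff_commutator {d e : ℝ → G → G} {B C : Mat n →L[ℝ] Mat n} (hc : IsFlow c A)
    (hd : IsFlow d B) (he : IsFlow e C) (h : ∀ x, C x = B (A x) - A (B x)) :
    (he.diff : Module.End ℂ (SmoothFn G E)) = hc.diff * hd.diff - hd.diff * hc.diff := by
  ext f g
  obtain ⟨F, hF, e⟩ := f.2 g
  have hs : IsSymmSndFDerivAt ℝ F (mat g) :=
    hF.isSymmSndFDerivAt (by
      rw [minSmoothness_of_isRCLikeNormedField]; norm_cast)
  change (he.diff f : G → E) g = (hc.diff (hd.diff f) : G → E) g - (hd.diff (hc.diff f) : G → E) g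
  rw [he.diff_eq f hF e, hc.diff_diff_eq hd f hF e, hd.diff_diff_eq hc f hF e, h,
    hs (A (mat g)) (B (mat g)), map_sub]
  abel

end Flow

/-- Multiplication by `X` from the right, as a linear vector field. -/
noncomputable def mulRightL (X : Mat n) : Mat n →L[ℝ] Mat n :=
  (ContinuousLinearMap.mul ℝ (Mat n)).flip X

/-- Multiplication by `-X` from the left, as a linear vector field. -/
noncomputable def mulLeftL (X : Mat n) : Mat n →L[ℝ] Mat n :=
  ContinuousLinearMap.mul ℝ (Mat n) (-X)

theorem isFlow_right (X : lieAlg G) :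
    IsFlow (fun t g => g * expG (t • X)) (mulRightL (X : Mat n)) where
  zero h := by simp only [expG_smul]; rw [oneParam_zero, mul_one]
  cont h := by simp only [expG_smul]; exact continuous_const.mul (continuous_oneParam _)
  hasDeriv h := by
    simp only [expG_smul, mat_mul]
    exact (hasDerivAt_mat_oneParam (coe_mem_expSet X)).const_mul (mat h)

theorem isFlow_left (X : lieAlg G) :
    IsFlow (fun t g => expG ((-t) • X) * g) (mulLeftL (X : Mat n)) where
  zero h := by simp only [expG_smul]; rw [neg_zero, oneParam_zero, one_mul]
  cont h := by
    simp only [expG_smul]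
    exact ((continuous_oneParam (coe_mem_expSet X)).comp continuous_neg).mul continuous_const
  hasDeriv h := by
    have e : ∀ t : ℝ, (-t) • X = t • (-X) := fun t => by simp
    simp only [e, expG_smul, mat_mul]
    exact (hasDerivAt_mat_oneParam (coe_mem_expSet (-X))).mul_const (mat h)

/-- `(R_X f)(g) = d/dt f(g exp(tX))` at `t = 0`, on smooth functions. -/
noncomputable def rDeriv (X : lieAlg G) : Module.End ℂ (SmoothFn G E) := (isFlow_right X).diff

/-- `(L_X f)(g) = d/dt f(exp(-tX) g)` at `t = 0`, on smooth functions. -/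
noncomputable def lDeriv (X : lieAlg G) : Module.End ℂ (SmoothFn G E) := (isFlow_left X).diff

theorem rDeriv_apply (X : lieAlg G) (f : SmoothFn G E) (g : G) :
    (rDeriv X f : G → E) g = deriv (fun t : ℝ => (f : G → E) (g * expG (t • X))) 0 := rfl

theorem lDeriv_apply (X : lieAlg G) (f : SmoothFn G E) (g : G) :
    (lDeriv X f : G → E) g = deriv (fun t : ℝ => (f : G → E) (expG ((-t) • X) * g)) 0 := rfl

theorem rDeriv_lie (X Y : lieAlg G) : (rDeriv ⁅X, Y⁆ : Module.End ℂ (SmoothFn G E)) =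
    rDeriv X * rDeriv Y - rDeriv Y * rDeriv X :=
  (isFlow_right X).diff_commutator (isFlow_right Y) (isFlow_right ⁅X, Y⁆) fun x => by
    simp [mulRightL, LieRing.of_associative_ring_bracket, mul_assoc]

theorem lDeriv_lie (X Y : lieAlg G) : (lDeriv ⁅X, Y⁆ : Module.End ℂ (SmoothFn G E)) =
    lDeriv X * lDeriv Y - lDeriv Y * lDeriv X :=
  (isFlow_left X).diff_commutator (isFlow_left Y) (isFlow_left ⁅X, Y⁆) fun x => by
    simp [mulLeftL, LieRing.of_associative_ring_bracket, mul_assoc]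

/-- `X ↦ R_X` as a real linear map. -/
noncomputable def rLin (G : LinGrp n) (E : Type*) [NormedAddCommGroup E] [NormedSpace ℂ E] :
    lieAlg G →ₗ[ℝ] Module.End ℂ (SmoothFn G E) where
  toFun := rDeriv
  map_add' X Y := by
    ext f g
    obtain ⟨F, hF, e⟩ := f.2 g
    change (rDeriv (X + Y) f : G → E) g = (rDeriv X f : G → E) g + (rDeriv Y f : G → E) g
    simp only [rDeriv, IsFlow.diff_eq _ f hF e]
    simp [mulRightL]
  map_smul' a X := by
    ext f g
    obtain ⟨F, hF, e⟩ := f.2 g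
    change (rDeriv (a • X) f : G → E) g = a • (rDeriv X f : G → E) g
    simp only [rDeriv, IsFlow.diff_eq _ f hF e]
    simp [mulRightL]

/-- `X ↦ L_X` as a real linear map. -/
noncomputable def lLin (G : LinGrp n) (E : Type*) [NormedAddCommGroup E] [NormedSpace ℂ E] :
    lieAlg G →ₗ[ℝ] Module.End ℂ (SmoothFn G E) where
  toFun := lDeriv
  map_add' X Y := by
    ext f g
    obtain ⟨F, hF, e⟩ := f.2 g
    change (lDeriv (X + Y) f : G → E) g = (lDeriv X f : G → E) g + (lDeriv Y f : G → E) g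
    simp only [lDeriv, IsFlow.diff_eq _ f hF e]
    simp [mulLeftL, add_comm]
  map_smul' a X := by
    ext f g
    obtain ⟨F, hF, e⟩ := f.2 g
    change (lDeriv (a • X) f : G → E) g = a • (lDeriv X f : G → E) g
    simp only [lDeriv, IsFlow.diff_eq _ f hF e]
    simp [mulLeftL]

/-! ### Enveloping algebras -/

section Complexify

variable {L : Type*} [LieRing L] [LieAlgebra ℝ L] {A : Type*} [Ring A] [Algebra ℂ A]

/-- The complex enveloping algebra `U(L ⊗ ℂ)` of a real Lie algebra `L`. -/
abbrev UC (L : Type*) [LieRing L] [LieAlgebra ℝ L] := UniversalEnvelopingAlgebra ℂ (ℂ ⊗[ℝ] L)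

/-- A bracket preserving real linear map from `L` to a complex associative algebra `A`, extended
complex linearly to `L ⊗ ℂ`. -/
noncomputable def complexLie (f : L →ₗ[ℝ] A) (hf : ∀ x y, f ⁅x, y⁆ = f x * f y - f y * f x) :
    ℂ ⊗[ℝ] L →ₗ⁅ℂ⁆ A :=
  { TensorProduct.AlgebraTensorModule.lift
      ((LinearMap.lsmul ℂ (L →ₗ[ℝ] A)).flip f) with
    map_lie' := by
      intro x y
      induction x using TensorProduct.induction_on with
      | zero => simp
      | add x₁ x₂ h₁ h₂ =>
        simp only [AddHom.toFun_eq_coe, LinearMap.coe_toAddHom, add_lie, map_add] at *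
        rw [h₁, h₂]
      | tmul a x =>
        induction y using TensorProduct.induction_on with
        | zero => simp
        | add y₁ y₂ h₁ h₂ =>
          simp only [AddHom.toFun_eq_coe, LinearMap.coe_toAddHom, lie_add, map_add] at *
          rw [h₁, h₂]
        | tmul b y =>
          simp [hf, LieRing.of_associative_ring_bracket, smul_sub, mul_smul, smul_comm a b] }

theorem complexLie_tmul (f : L →ₗ[ℝ] A) (hf : ∀ x y, f ⁅x, y⁆ = f x * f y - f y * f x) (a : ℂ)
    (x : L) : complexLie f hf (a ⊗ₜ x) = a • f x := by
  change TensorProduct.AlgebraTensorModule.lift _ (a ⊗ₜ[ℝ] x) = _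
  simp

/-- A bracket preserving real linear map from `L` to a complex associative algebra `A`, extended
to an algebra homomorphism on `U(L ⊗ ℂ)`. -/
noncomputable def envLift (f : L →ₗ[ℝ] A) (hf : ∀ x y, f ⁅x, y⁆ = f x * f y - f y * f x) :
    UC L →ₐ[ℂ] A :=
  UniversalEnvelopingAlgebra.lift ℂ (complexLie f hf)

/-- The inclusion `L → U(L ⊗ ℂ)`. -/
noncomputable def envι (L : Type*) [LieRing L] [LieAlgebra ℝ L] : L →ₗ[ℝ] UC L :=
  ((UniversalEnvelopingAlgebra.ι ℂ : ℂ ⊗[ℝ] L →ₗ⁅ℂ⁆ UC L) : ℂ ⊗[ℝ] L →ₗ[ℂ] UC L).restrictScalars ℝ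
    ∘ₗ TensorProduct.mk ℝ ℂ L 1

theorem envι_apply (x : L) : envι L x = UniversalEnvelopingAlgebra.ι ℂ ((1 : ℂ) ⊗ₜ[ℝ] x) := rfl

theorem envι_lie (x y : L) : envι L ⁅x, y⁆ = envι L x * envι L y - envι L y * envι L x := by
  simp only [envι_apply]
  rw [← LieRing.of_associative_ring_bracket, ← LieHom.map_lie]
  simp

theorem envLift_envι (f : L →ₗ[ℝ] A) (hf : ∀ x y, f ⁅x, y⁆ = f x * f y - f y * f x) (x : L) :
    envLift f hf (envι L x) = f x := by
  rw [envLift, envι_apply, UniversalEnvelopingAlgebra.lift_ι_apply, complexLie_tmul, one_smul]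

/-- Functoriality of `U(L ⊗ ℂ)`. -/
noncomputable def envMap {L' : Type*} [LieRing L'] [LieAlgebra ℝ L'] (φ : L →ₗ⁅ℝ⁆ L') :
    UC L →ₐ[ℂ] UC L' :=
  envLift (envι L' ∘ₗ (φ : L →ₗ[ℝ] L')) fun x y => by simp [envι_lie]

end Complexify

/-- The right action `R` of `U(𝔤_ℂ)` on `C^∞(G, E)`. -/
noncomputable def rAct : UC (lieAlg G) →ₐ[ℂ] Module.End ℂ (SmoothFn G E) :=
  envLift (A := Module.End ℂ (SmoothFn G E)) (rLin G E) rDeriv_lie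

/-- The left action `L` of `U(𝔤_ℂ)` on `C^∞(G, E)`. -/
noncomputable def lAct : UC (lieAlg G) →ₐ[ℂ] Module.End ℂ (SmoothFn G E) :=
  envLift (A := Module.End ℂ (SmoothFn G E)) (lLin G E) lDeriv_lie

theorem rAct_ι (X : lieAlg G) : (rAct (envι _ X) : Module.End ℂ (SmoothFn G E)) = rDeriv X :=
  envLift_envι _ _ X

theorem lAct_ι (X : lieAlg G) : (lAct (envι _ X) : Module.End ℂ (SmoothFn G E)) = lDeriv X :=
  envLift_envι _ _ X

/-- The adjoint action of `g ∈ G` on its Lie algebra. -/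
noncomputable def Ad (g : G) : lieAlg G →ₗ⁅ℝ⁆ lieAlg G where
  toFun X := ⟨mat g * X * mat g⁻¹, conj_mem_expSet g X.2⟩
  map_add' X Y := Subtype.ext (by simp [mul_add, add_mul])
  map_smul' a X := Subtype.ext (by simp)
  map_lie' {X Y} := Subtype.ext (by
    have h : ∀ x y : Mat n, mat g * (x * y) * mat g⁻¹ =
        (mat g * x * mat g⁻¹) * (mat g * y * mat g⁻¹) := fun x y => by
      calc mat g * (x * y) * mat g⁻¹ = mat g * x * 1 * y * mat g⁻¹ := by
            simp only [mul_one, mul_assoc]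
        _ = _ := by rw [← mat_inv_mul g]; simp only [mul_assoc]
    simp only [LieSubalgebra.coe_bracket, LieRing.of_associative_ring_bracket, mul_sub, sub_mul, h])

/-- The algebra `Z_G` of `Ad(G)`-invariant elements of `U(𝔤_ℂ)`. -/
noncomputable def ZG (G : LinGrp n) : Subalgebra ℂ (UC (lieAlg G)) :=
  ⨅ g : G, AlgHom.equalizer (envMap (Ad g)) (AlgHom.id ℂ _)

theorem mem_ZG {u : UC (lieAlg G)} : u ∈ ZG G ↔ ∀ g : G, envMap (Ad g) u = u := by
  simp [ZG, AlgHom.mem_equalizer]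


/-! ### Pairs of real reductive groups -/

/-- The inclusion of a subgroup. -/
def incl {G' : LinGrp n} (hle : G' ≤ G) (h : G') : G := ⟨h, hle h.2⟩

/-- The inclusion of the Lie algebra of a subgroup. -/
def lieIncl {G' : LinGrp n} (hle : G' ≤ G) : lieAlg G' →ₗ⁅ℝ⁆ lieAlg G where
  toFun X := ⟨X, fun t => by
    obtain ⟨h, hh⟩ := coe_mem_expSet X t
    exact ⟨incl hle h, hh⟩⟩
  map_add' _ _ := rfl
  map_smul' _ _ := rfl
  map_lie' := rfl

/-- The compact subgroup `K = G ∩ O(n)`. -/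
def compactK (G : LinGrp n) : Subgroup G where
  carrier := {k | (mat k)ᵀ * mat k = 1}
  one_mem' := by simp [mat_one]
  mul_mem' {a b} ha hb := by
    change (mat a * mat b)ᵀ * (mat a * mat b) = 1
    have ha' : (mat a)ᵀ * mat a = 1 := ha
    rw [Matrix.transpose_mul, mul_assoc, ← mul_assoc _ (mat a), ha', one_mul]
    exact hb
  inv_mem' {k} hk := by
    have hk' : (mat k)ᵀ * mat k = 1 := hk
    have h : mat k⁻¹ = (mat k)ᵀ := by
      calc mat k⁻¹ = (mat k)ᵀ * mat k * mat k⁻¹ := by rw [hk', one_mul]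
        _ = _ := by rw [mul_assoc, mat_mul_inv, mul_one]
    change (mat k⁻¹)ᵀ * mat k⁻¹ = 1
    rw [h, Matrix.transpose_transpose, ← h, mat_mul_inv]

/-- A real reductive linear group in standard position: a closed subgroup `G` of `GL(n, ℝ)`,
stable under the transpose, with the Cartan decomposition `G = K exp 𝔭`, where `K = G ∩ O(n)` and
`𝔭` is the space of symmetric matrices in the Lie algebra. -/
structure IsRealReductive (G : LinGrp n) : Prop where
  transpose_mem : ∀ g : G, ∃ h : G, mat h = (mat g)ᵀ
  cartan : ∀ g : G, ∃ k ∈ compactK G, ∃ X : lieAlg G, (X : Mat n)ᵀ = X ∧ g = k * expG X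

/-- A real reductive subgroup of `GL(n, ℝ)`: a closed subgroup that some inner automorphism of
`GL(n, ℝ)` brings into standard position. -/
def IsConjRealReductive (G : LinGrp n) : Prop :=
  ∃ (a : GL (Fin n) ℝ) (G₁ : LinGrp n), IsRealReductive G₁ ∧ ∀ x, x ∈ G₁ ↔ a⁻¹ * x * a ∈ G

/-- `G ∩ O(n)` is a maximal compact subgroup of `G`. -/
def IsMaximalCompactK (G : LinGrp n) : Prop :=
  ∀ C : Subgroup G, IsCompact (C : Set G) → compactK G ≤ C → C = compactK G

/-! ### Harish-Chandra parametrization of infinitesimal characters -/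

section HarishChandra

variable {𝔤 : Type*} [LieRing 𝔤] [LieAlgebra ℝ 𝔤] (𝔧 : LieSubalgebra ℝ 𝔤)

/-- The complexification `𝔧_ℂ`. -/
abbrev Cplx := ℂ ⊗[ℝ] 𝔧

/-- The root space `{x ∈ 𝔤_ℂ : [H, x] = α(H) x for all H ∈ 𝔧_ℂ}`. -/
noncomputable def rootSpace (α : Module.Dual ℂ (Cplx 𝔧)) : Submodule ℂ (ℂ ⊗[ℝ] 𝔤) where
  carrier := {x | ∀ H : Cplx 𝔧, ⁅𝔧.toSubmodule.subtype.baseChange ℂ H, x⁆ = α H • x}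
  zero_mem' H := by simp
  add_mem' hx hy H := by rw [lie_add, hx H, hy H, smul_add]
  smul_mem' c x hx H := by rw [lie_smul, hx H, smul_comm]

/-- `α` is a root of `𝔧_ℂ` in `𝔤_ℂ`. -/
def IsRoot (α : Module.Dual ℂ (Cplx 𝔧)) : Prop := α ≠ 0 ∧ rootSpace 𝔧 α ≠ ⊥

/-- `Δ` is a positive system: the set of roots is the disjoint union of `Δ` and `-Δ`, and a
root that is the sum of two elements of `Δ` lies in `Δ`. -/
structure IsPositiveSystem (Δ : Finset (Module.Dual ℂ (Cplx 𝔧))) : Prop where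
  isRoot_iff : ∀ α, IsRoot 𝔧 α ↔ α ∈ Δ ∨ -α ∈ Δ
  disjoint : ∀ α ∈ Δ, -α ∉ Δ
  add_mem : ∀ α ∈ Δ, ∀ β ∈ Δ, IsRoot 𝔧 (α + β) → α + β ∈ Δ

/-- Half the sum of the positive roots. -/
noncomputable def rho (Δ : Finset (Module.Dual ℂ (Cplx 𝔧))) : Module.Dual ℂ (Cplx 𝔧) :=
  (1 / 2 : ℂ) • ∑ α ∈ Δ, α

/-- The subspace `𝔫⁻ U(𝔤_ℂ) + U(𝔤_ℂ) 𝔫⁺` of `U(𝔤_ℂ)`. -/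
noncomputable def nilpotentPart (Δ : Finset (Module.Dual ℂ (Cplx 𝔧))) : Submodule ℂ (UC 𝔤) :=
  Submodule.span ℂ
      {w | ∃ α ∈ Δ, ∃ x ∈ rootSpace 𝔧 (-α), ∃ u, w = UniversalEnvelopingAlgebra.ι ℂ x * u} ⊔
    Submodule.span ℂ
      {w | ∃ α ∈ Δ, ∃ x ∈ rootSpace 𝔧 α, ∃ u, w = u * UniversalEnvelopingAlgebra.ι ℂ x}

/-- `c` is the value `⟨γ'(u), lam - ρ⟩`, for every choice of the positive system. Here `γ'(u)` is
the component of `u` in `U(𝔧_ℂ)` along `𝔫⁻ U(𝔤_ℂ) + U(𝔤_ℂ) 𝔫⁺`, and an element of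
`U(𝔧_ℂ) = S(𝔧_ℂ)` is evaluated at a linear form through the algebra homomorphism
`φ : U(𝔧_ℂ) → ℂ` that extends the form. -/
def IsHarishChandraValue (lam : Module.Dual ℂ (Cplx 𝔧)) (u : UC 𝔤) (c : ℂ) : Prop :=
  ∀ Δ : Finset (Module.Dual ℂ (Cplx 𝔧)), IsPositiveSystem 𝔧 Δ →
    ∀ φ : UC 𝔧 →ₐ[ℂ] ℂ,
      (∀ H : Cplx 𝔧, φ (UniversalEnvelopingAlgebra.ι ℂ H) = (lam - rho 𝔧 Δ) H) →
      ∀ p : UC 𝔧, u - envMap 𝔧.incl p ∈ nilpotentPart 𝔧 Δ → c = φ p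

end HarishChandra

/-- The character `χ_lam : Z_G → ℂ` attached to `lam ∈ 𝔧_ℂ^∨` by the Harish-Chandra isomorphism,
normalized so that the trivial representation has the parameter `ρ`. The value at `u` is the
number `⟨γ'(u), lam - ρ⟩`, which is the same for all positive systems. -/
noncomputable def chi (𝔧 : LieSubalgebra ℝ (lieAlg G)) (lam : Module.Dual ℂ (Cplx 𝔧))
    (u : ZG G) : ℂ :=
  Classical.epsilon fun c => IsHarishChandraValue 𝔧 lam (u : UC (lieAlg G)) c

/-! ### Continuous representations and smooth vectors -/

/-- A continuous representation of `G` on a Banach space `H`. -/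
structure BanachRep (G : LinGrp n) (H : Type*) [NormedAddCommGroup H] [NormedSpace ℂ H] where
  /-- the underlying homomorphism -/
  toHom : G →* (H →L[ℂ] H)
  continuous_action : Continuous fun p : G × H => toHom p.1 p.2

section Rep

variable {H : Type*} [NormedAddCommGroup H] [NormedSpace ℂ H] (π : BanachRep G H)

/-- The closed `G`-invariant subspaces. -/
abbrev ClosedInvariant := {W : Submodule ℂ H // IsClosed (W : Set H) ∧
  ∀ g : G, ∀ v ∈ W, π.toHom g v ∈ W}

/-- `Hom_K(ρ, π|_K)`. -/
def homK {m : ℕ} (ρ : Representation ℂ (compactK G) (Fin m → ℂ)) :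
    Submodule ℂ ((Fin m → ℂ) →ₗ[ℂ] H) where
  carrier := {T | ∀ k : compactK G, ∀ x, T (ρ k x) = π.toHom k (T x)}
  zero_mem' k x := by simp
  add_mem' h₁ h₂ k x := by simp [h₁ k x, h₂ k x]
  smul_mem' c T h k x := by simp [h k x]

/-- Admissible representations: those of finite length in which every irreducible
finite-dimensional representation of `K` has finite multiplicity. -/
structure IsAdmissible : Prop where
  finite_length : ∃ N : ℕ, ∀ s : LTSeries (ClosedInvariant π), s.length ≤ N
  finite_mult : ∀ (m : ℕ) (ρ : Representation ℂ (compactK G) (Fin m → ℂ)),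
    (∀ x, Continuous fun k => ρ k x) → ρ.IsIrreducible → FiniteDimensional ℂ (homK π ρ)

/-- The space of smooth vectors as a subspace of `H`. -/
def smoothVectors : Submodule ℂ H where
  carrier := {v | IsSmooth fun g => π.toHom g v}
  zero_mem' := by
    have h : (fun g => π.toHom g (0 : H)) = 0 := by ext g; simp
    change IsSmooth _
    rw [h]
    exact (SmoothFn G H).zero_mem
  add_mem' {v w} hv hw := by
    have h : (fun g => π.toHom g (v + w)) = (fun g => π.toHom g v) + fun g => π.toHom g w := by
      ext g; simp
    change IsSmooth _
    rw [h]
    exact (SmoothFn G H).add_mem hv hw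
  smul_mem' c v hv := by
    have h : (fun g => π.toHom g (c • v)) = c • fun g => π.toHom g v := by
      ext g; simp
    change IsSmooth _
    rw [h]
    exact (SmoothFn G H).smul_mem c hv

/-- The space `H^∞` of smooth vectors. It carries its own topology, which is finer than the
topology of `H`. -/
def SmoothVec : Type _ := smoothVectors π

noncomputable instance : AddCommGroup (SmoothVec π) := inferInstanceAs (AddCommGroup (smoothVectors π))
noncomputable instance : Module ℂ (SmoothVec π) := inferInstanceAs (Module ℂ (smoothVectors π))

variable {π}

/-- The inclusion of `H^∞` in `H`. -/
noncomputable def SmoothVec.val : SmoothVec π →ₗ[ℂ] H := (smoothVectors π).subtype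

theorem SmoothVec.val_injective : Function.Injective (SmoothVec.val : SmoothVec π → H) :=
  Subtype.val_injective

/-- The smooth orbit map `g ↦ π(g) v` of a smooth vector. -/
noncomputable def orbit : SmoothVec π →ₗ[ℂ] SmoothFn G H where
  toFun v := ⟨fun g => π.toHom g v.val, v.2⟩
  map_add' v w := by ext g; simp
  map_smul' c v := by ext g; simp

theorem orbit_apply (v : SmoothVec π) (g : G) : (orbit v : G → H) g = π.toHom g v.val := rfl

theorem orbit_one (v : SmoothVec π) : (orbit v : G → H) 1 = v.val := by
  rw [orbit_apply, map_one]; rfl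

theorem toHom_rDeriv_orbit (X : lieAlg G) (v : SmoothVec π) (g : G) :
    π.toHom g ((rDeriv X (orbit v) : G → H) 1) = (rDeriv X (orbit v) : G → H) g := by
  obtain ⟨F, hF, e⟩ := (orbit v).2 1
  have h1 := ((isFlow_right X).hasDerivAt hF e).self_of_nhds
  have h2 := ((π.toHom g).restrictScalars ℝ).hasFDerivAt.comp_hasDerivAt 0 h1
  rw [rDeriv_apply, rDeriv_apply, h1.deriv]
  refine h2.deriv.symm.trans ?_
  congr 1
  ext t
  simp [orbit_apply, map_mul]

/-- `dπ(X)v = d/dt π(exp(tX))v` at `t = 0`. -/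
noncomputable def dActX (X : lieAlg G) : Module.End ℂ (SmoothVec π) where
  toFun v := ⟨(rDeriv X (orbit v) : G → H) 1, by
    change IsSmooth fun g => π.toHom g ((rDeriv X (orbit v) : G → H) 1)
    simp only [toHom_rDeriv_orbit]
    exact (rDeriv X (orbit v)).2⟩
  map_add' v w := Subtype.ext (by simp; rfl)
  map_smul' c v := Subtype.ext (by simp; rfl)

theorem val_dActX (X : lieAlg G) (v : SmoothVec π) :
    (dActX X v).val = (rDeriv X (orbit v) : G → H) 1 := rfl

theorem val_dActX_eq (X : lieAlg G) (v : SmoothVec π) :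
    (dActX X v).val = deriv (fun t : ℝ => π.toHom (expG (t • X)) v.val) 0 := by
  rw [val_dActX, rDeriv_apply]; simp [orbit_apply]

theorem orbit_dActX (X : lieAlg G) (v : SmoothVec π) : orbit (dActX X v) = rDeriv X (orbit v) := by
  ext g
  rw [orbit_apply, val_dActX, toHom_rDeriv_orbit]

variable (π) in
/-- `X ↦ dπ(X)` as a real linear map. -/
noncomputable def dLin : lieAlg G →ₗ[ℝ] Module.End ℂ (SmoothVec π) where
  toFun := dActX
  map_add' X Y := by
    ext v
    apply SmoothVec.val_injective
    change (rLin G H (X + Y) (orbit v) : G → H) 1 = _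
    rw [map_add]; rfl
  map_smul' a X := by
    ext v
    apply SmoothVec.val_injective
    change (rLin G H (a • X) (orbit v) : G → H) 1 = _
    rw [map_smul]; rfl

theorem dLin_lie (X Y : lieAlg G) :
    dLin π ⁅X, Y⁆ = dLin π X * dLin π Y - dLin π Y * dLin π X := by
  ext v
  apply SmoothVec.val_injective
  change (rDeriv ⁅X, Y⁆ (orbit v) : G → H) 1 =
    (rDeriv X (orbit (dActX Y v)) : G → H) 1 - (rDeriv Y (orbit (dActX X v)) : G → H) 1
  rw [orbit_dActX, orbit_dActX, rDeriv_lie]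
  rfl

variable (π) in
/-- The action `dπ` of `U(𝔤_ℂ)` on `H^∞`. -/
noncomputable def dAct : UC (lieAlg G) →ₐ[ℂ] Module.End ℂ (SmoothVec π) :=
  envLift (A := Module.End ℂ (SmoothVec π)) (dLin π) dLin_lie

/-- The topology of `H^∞`, defined by the seminorms `v ↦ ‖dπ(u)v‖` for `u ∈ U(𝔤_ℂ)`. -/
noncomputable instance : TopologicalSpace (SmoothVec π) :=
  ⨅ u : UC (lieAlg G), TopologicalSpace.induced (fun v => (dAct π u v).val) inferInstance

noncomputable instance : IsTopologicalAddGroup (SmoothVec π) :=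
  topologicalAddGroup_iInf fun u =>
    topologicalAddGroup_induced (SmoothVec.val ∘ₗ dAct π u : SmoothVec π →ₗ[ℂ] H)

noncomputable instance : ContinuousSMul ℂ (SmoothVec π) :=
  continuousSMul_iInf fun u =>
    continuousSMul_induced (SmoothVec.val ∘ₗ dAct π u : SmoothVec π →ₗ[ℂ] H)

theorem continuous_dAct (u : UC (lieAlg G)) : Continuous (dAct π u) := by
  refine continuous_iInf_rng.2 fun w => continuous_induced_rng.2 ?_
  have h : (fun v => (dAct π w v).val) ∘ dAct π u = fun v => (dAct π (w * u) v).val := by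
    ext v; simp
  rw [h]
  exact continuous_iInf_dom (i := w * u) continuous_induced_dom

theorem smooth_translate (g : G) {v : H} (hv : v ∈ smoothVectors π) :
    π.toHom g v ∈ smoothVectors π := fun h => by
  obtain ⟨F, hF, e⟩ := hv (h * g)
  refine ⟨fun x => F (x * mat g), ?_, ?_⟩
  · exact ContDiffAt.comp (g := F) (mat h) (by rwa [← mat_mul])
      (mulRightL (mat g)).contDiff.contDiffAt
  · have : Filter.Tendsto (fun h' => h' * g) (𝓝 h) (𝓝 (h * g)) :=
      (continuous_mul_const g).tendsto h
    filter_upwards [this.eventually e] with h' he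
    rw [← mat_mul, ← he, map_mul]
    rfl

variable (π) in
/-- The representation `π^∞` of `G` on `H^∞`. -/
noncomputable def smoothRep : Representation ℂ G (SmoothVec π) where
  toFun g :=
    { toFun := fun v => ⟨π.toHom g v.val, smooth_translate g v.2⟩
      map_add' := fun v w => Subtype.ext (by simp; rfl)
      map_smul' := fun c v => Subtype.ext (by simp; rfl) }
  map_one' := by
    refine LinearMap.ext fun v => SmoothVec.val_injective ?_
    change π.toHom 1 v.val = v.val
    simp
  map_mul' g h := by
    refine LinearMap.ext fun v => SmoothVec.val_injective ?_
    change π.toHom (g * h) v.val = π.toHom g (π.toHom h v.val)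
    simp

theorem val_smoothRep (g : G) (v : SmoothVec π) : (smoothRep π g v).val = π.toHom g v.val := rfl

variable (π)

/-- `π^∞` is irreducible: `H^∞` is non-zero and its only closed `G`-invariant subspaces are
`0` and `H^∞`. -/
def IsIrreducibleSmooth : Prop :=
  Nontrivial (SmoothVec π) ∧ ∀ W : Submodule ℂ (SmoothVec π), IsClosed (W : Set (SmoothVec π)) →
    (∀ g : G, ∀ v ∈ W, smoothRep π g v ∈ W) → W = ⊥ ∨ W = ⊤

/-- `π^∞` has the infinitesimal character `χ`: each `u ∈ Z_G` acts on `H^∞` by `χ(u)`. -/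
def HasInfinitesimalCharacter (χ : ZG G → ℂ) : Prop :=
  ∀ (u : ZG G) (v : SmoothVec π), dAct π (u : UC (lieAlg G)) v = χ u • v

variable {π}

/-- `v` is fixed by `K`. -/
def IsSpherical (v : SmoothVec π) : Prop := ∀ k ∈ compactK G, smoothRep π k v = v

/-- `v` is `K`-finite. The `K`-finite vectors form the underlying `(𝔤, K)`-module `π_K`. -/
def IsKFinite (v : SmoothVec π) : Prop :=
  FiniteDimensional ℂ (Submodule.span ℂ (Set.range fun k : compactK G => smoothRep π k v))

/-- `v` is cyclic in `π_K`, that is, `U(𝔤_ℂ) v = π_K`. -/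
def IsCyclicVector (v : SmoothVec π) : Prop := ∀ w : SmoothVec π, IsKFinite w ↔ ∃ u, dAct π u v = w

/-! Elements of the contragredient are taken as continuous linear forms on `H^∞`. -/

/-- `dπ(X)` as a continuous linear map. -/
noncomputable def dActXL (X : lieAlg G) : SmoothVec π →L[ℂ] SmoothVec π where
  toLinearMap := dActX X
  cont := by
    have := continuous_dAct (π := π) (envι _ X)
    rwa [dAct, envLift_envι] at this

/-- The contragredient action `ξ ↦ -ξ ∘ dπ(X)` of `X ∈ 𝔤` on continuous linear forms. -/
noncomputable def dualActX (X : lieAlg G) : Module.End ℂ (SmoothVec π →L[ℂ] ℂ) where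
  toFun ξ := -(ξ.comp (dActXL X))
  map_add' ξ η := by rw [ContinuousLinearMap.add_comp, neg_add]
  map_smul' c ξ := by rw [ContinuousLinearMap.smul_comp, RingHom.id_apply, smul_neg]

theorem dualActX_apply (X : lieAlg G) (ξ : SmoothVec π →L[ℂ] ℂ) (v : SmoothVec π) :
    dualActX X ξ v = -ξ (dActX X v) := rfl

variable (π) in
/-- The contragredient action as a real linear map. -/
noncomputable def dualLin : lieAlg G →ₗ[ℝ] Module.End ℂ (SmoothVec π →L[ℂ] ℂ) where
  toFun := dualActX
  map_add' X Y := by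
    ext ξ v
    change -ξ (dLin π (X + Y) v) = -ξ (dLin π X v) + -ξ (dLin π Y v)
    simp [add_comm]
  map_smul' a X := by
    ext ξ v
    change -ξ (dLin π (a • X) v) = a • (-ξ (dLin π X v))
    have h : dLin π (a • X) v = (a : ℂ) • dLin π X v := by
      rw [map_smul]; rfl
    rw [h, map_smul]
    simp

theorem dualLin_lie (X Y : lieAlg G) :
    dualLin π ⁅X, Y⁆ = dualLin π X * dualLin π Y - dualLin π Y * dualLin π X := by
  ext ξ v
  change -ξ (dLin π ⁅X, Y⁆ v) = - -ξ (dLin π Y (dLin π X v)) - - -ξ (dLin π X (dLin π Y v))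
  rw [dLin_lie]
  simp

variable (π) in
/-- The contragredient action of `U(𝔤_ℂ)` on continuous linear forms on `H^∞`. -/
noncomputable def dualAct : UC (lieAlg G) →ₐ[ℂ] Module.End ℂ (SmoothVec π →L[ℂ] ℂ) :=
  envLift (A := Module.End ℂ (SmoothVec π →L[ℂ] ℂ)) (dualLin π) dualLin_lie

/-- The linear form `ξ` is fixed by `K`. -/
def IsSphericalForm (ξ : SmoothVec π →L[ℂ] ℂ) : Prop :=
  ∀ k ∈ compactK G, ∀ v, ξ (smoothRep π k⁻¹ v) = ξ v

/-- The linear form `ξ` is `K`-finite. The `K`-finite continuous linear forms on `H^∞` form the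
`(𝔤, K)`-module `π_K^∨` contragredient to `π_K`. -/
def IsKFiniteForm (ξ : SmoothVec π →L[ℂ] ℂ) : Prop :=
  FiniteDimensional ℂ (Submodule.span ℂ (Set.range fun k : compactK G =>
    (ξ : SmoothVec π →ₗ[ℂ] ℂ) ∘ₗ smoothRep π (k : G)⁻¹))

/-- `ξ` is cyclic in `π_K^∨`, that is, `U(𝔤_ℂ) ξ = π_K^∨`. -/
def IsCyclicForm (ξ : SmoothVec π →L[ℂ] ℂ) : Prop :=
  ∀ η : SmoothVec π →L[ℂ] ℂ, IsKFiniteForm η ↔ ∃ u, dualAct π u ξ = η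

end Rep

/-- The space `Hom_{G'}(π^∞, τ^∞)` of continuous `G'`-homomorphisms. -/
def SymmetryBreaking {G' : LinGrp n} (hle : G' ≤ G) {H H' : Type*} [NormedAddCommGroup H]
    [NormedSpace ℂ H] [NormedAddCommGroup H'] [NormedSpace ℂ H'] (π : BanachRep G H)
    (τ : BanachRep G' H') : Submodule ℂ (SmoothVec π →L[ℂ] SmoothVec τ) where
  carrier := {T | ∀ (h : G') (v : SmoothVec π),
    T (smoothRep π (incl hle h) v) = smoothRep τ h (T v)}
  zero_mem' h v := by simp
  add_mem' h₁ h₂ h v := by simp [h₁ h v, h₂ h v]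
  smul_mem' c T hT h v := by simp [hT h v]

/-! ### Shintani functions of moderate growth -/

/-- The norm `‖g ⊕ ᵗg⁻¹‖`, where `‖·‖` is the operator norm on `M(2n, ℝ)`. -/
noncomputable def groupNorm (g : G) : ℝ := ‖Matrix.fromBlocks (mat g) 0 0 (mat g⁻¹)ᵀ‖

theorem one_le_groupNorm [Nonempty (Fin n)] (g : G) : 1 ≤ groupNorm g := by
  set x : Matrix (Fin n ⊕ Fin n) (Fin n ⊕ Fin n) ℝ :=
    Matrix.fromBlocks (mat g) 0 0 (mat g⁻¹)ᵀ with hx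
  set J : Matrix (Fin n ⊕ Fin n) (Fin n ⊕ Fin n) ℝ := Matrix.fromBlocks 0 1 1 0 with hJ
  have hJs : star J = J := by
    rw [Matrix.star_eq_conjTranspose, hJ, Matrix.fromBlocks_conjTranspose]; simp
  have hJJ : J * J = 1 := by
    rw [hJ, Matrix.fromBlocks_multiply]; simp [Matrix.fromBlocks_one]
  have hJn : ‖J‖ = 1 := by
    refine CStarRing.norm_of_mem_unitary ?_
    rw [Unitary.mem_iff, hJs]; exact ⟨hJJ, hJJ⟩
  have hxJ : x * (J * star x * J) = 1 := by
    rw [Matrix.star_eq_conjTranspose, hx, hJ, Matrix.fromBlocks_conjTranspose,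
      Matrix.fromBlocks_multiply, Matrix.fromBlocks_multiply, Matrix.fromBlocks_multiply]
    have e : (mat g⁻¹)ᵀ * (mat g)ᵀ = 1 := by
      rw [← Matrix.transpose_mul, mat_mul_inv, Matrix.transpose_one]
    simp [Matrix.conjTranspose_eq_transpose_of_trivial, mat_mul_inv, e, Matrix.fromBlocks_one]
  have h1 : (1 : ℝ) ≤ ‖x‖ * ‖x‖ := by
    calc (1 : ℝ) = ‖x * (J * star x * J)‖ := by rw [hxJ]; exact CStarRing.norm_one.symm
      _ ≤ ‖x‖ * (‖J‖ * ‖star x‖ * ‖J‖) := by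
        refine (norm_mul_le _ _).trans ?_
        gcongr
        refine (norm_mul_le _ _).trans ?_
        gcongr
        exact norm_mul_le _ _
      _ = ‖x‖ * ‖x‖ := by rw [hJn, norm_star]; ring
  change 1 ≤ ‖x‖
  nlinarith [norm_nonneg x]

/-- There are `d ∈ ℝ` and constants `C(u)` with `|(R_u f)(x)| ≤ C(u) ‖x‖^d`. -/
def HasGrowthBound (f : SmoothFn G ℂ) : Prop :=
  ∃ d : ℝ, ∀ u : UC (lieAlg G), ∃ C : ℝ, ∀ x : G, ‖(rAct u f : G → ℂ) x‖ ≤ C * groupNorm x ^ d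

/-- `f` has moderate growth: it is right `K`-finite, `Z_G`-finite and satisfies the growth
bound. -/
structure HasModerateGrowth (f : SmoothFn G ℂ) : Prop where
  kFinite : FiniteDimensional ℂ
    (Submodule.span ℂ (Set.range fun k : compactK G => fun g : G => (f : G → ℂ) (g * k)))
  zFinite : FiniteDimensional ℂ
    (Submodule.span ℂ (Set.range fun u : ZG G => rAct (u : UC (lieAlg G)) f))
  growth : HasGrowthBound f

theorem hasGrowthBound_add {f₁ f₂ : SmoothFn G ℂ} (h₁ : HasGrowthBound f₁)
    (h₂ : HasGrowthBound f₂) : HasGrowthBound (f₁ + f₂) := by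
  rcases isEmpty_or_nonempty (Fin n) with hn | hn
  · have hs : ∀ x : G, x = 1 := fun x => mat_injective (Subsingleton.elim _ _)
    refine ⟨0, fun u => ⟨‖(rAct u (f₁ + f₂) : G → ℂ) 1‖, fun x => ?_⟩⟩
    rw [hs x]; simp
  · obtain ⟨d₁, h₁⟩ := h₁
    obtain ⟨d₂, h₂⟩ := h₂
    refine ⟨max d₁ d₂, fun u => ?_⟩
    obtain ⟨C₁, h₁⟩ := h₁ u
    obtain ⟨C₂, h₂⟩ := h₂ u
    refine ⟨|C₁| + |C₂|, fun x => ?_⟩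
    have hx := one_le_groupNorm x
    have hx0 : 0 ≤ groupNorm x := zero_le_one.trans hx
    calc ‖(rAct u (f₁ + f₂) : G → ℂ) x‖
        ≤ ‖(rAct u f₁ : G → ℂ) x‖ + ‖(rAct u f₂ : G → ℂ) x‖ := by
          rw [map_add]; exact norm_add_le _ _
      _ ≤ |C₁| * groupNorm x ^ d₁ + |C₂| * groupNorm x ^ d₂ := by
          refine add_le_add ((h₁ x).trans ?_) ((h₂ x).trans ?_) <;>
          · gcongr
            exact le_abs_self _
      _ ≤ |C₁| * groupNorm x ^ max d₁ d₂ + |C₂| * groupNorm x ^ max d₁ d₂ := by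
          have e₁ := Real.rpow_le_rpow_of_exponent_le hx (le_max_left d₁ d₂)
          have e₂ := Real.rpow_le_rpow_of_exponent_le hx (le_max_right d₁ d₂)
          gcongr
      _ = _ := by ring

/-- `C^∞_mod(G)`, the space of smooth functions of moderate growth. -/
def ModerateGrowth (G : LinGrp n) : Submodule ℂ (SmoothFn G ℂ) where
  carrier := {f | HasModerateGrowth f}
  zero_mem' :=
    { kFinite := FiniteDimensional.span_of_finite ℂ
        ((Set.finite_singleton (0 : G → ℂ)).subset (by rintro _ ⟨k, rfl⟩; rfl))
      zFinite := FiniteDimensional.span_of_finite ℂ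
        ((Set.finite_singleton (0 : SmoothFn G ℂ)).subset (by rintro _ ⟨k, rfl⟩; simp))
      growth := ⟨0, fun u => ⟨0, fun x => by simp⟩⟩ }
  add_mem' {f₁ f₂} h₁ h₂ :=
    { kFinite := by
        have := h₁.kFinite
        have := h₂.kFinite
        refine Submodule.finiteDimensional_of_le (S₂ :=
          Submodule.span ℂ (Set.range fun k : compactK G => fun g : G => (f₁ : G → ℂ) (g * k)) ⊔
          Submodule.span ℂ (Set.range fun k : compactK G => fun g : G => (f₂ : G → ℂ) (g * k)))
          (Submodule.span_le.2 ?_)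
        rintro _ ⟨k, rfl⟩
        exact Submodule.add_mem_sup (Submodule.subset_span ⟨k, rfl⟩)
          (Submodule.subset_span ⟨k, rfl⟩)
      zFinite := by
        have := h₁.zFinite
        have := h₂.zFinite
        refine Submodule.finiteDimensional_of_le (S₂ :=
          Submodule.span ℂ (Set.range fun u : ZG G => rAct (u : UC (lieAlg G)) f₁) ⊔
          Submodule.span ℂ (Set.range fun u : ZG G => rAct (u : UC (lieAlg G)) f₂))
          (Submodule.span_le.2 ?_)
        rintro _ ⟨k, rfl⟩
        simp only [map_add]
        exact Submodule.add_mem_sup (Submodule.subset_span ⟨k, rfl⟩)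
          (Submodule.subset_span ⟨k, rfl⟩)
      growth := hasGrowthBound_add h₁.growth h₂.growth }
  smul_mem' c f h :=
    { kFinite := by
        have := h.kFinite
        refine Submodule.finiteDimensional_of_le (S₂ :=
          Submodule.span ℂ (Set.range fun k : compactK G => fun g : G => (f : G → ℂ) (g * k)))
          (Submodule.span_le.2 ?_)
        rintro _ ⟨k, rfl⟩
        exact Submodule.smul_mem _ c (Submodule.subset_span ⟨k, rfl⟩)
      zFinite := by
        have := h.zFinite
        refine Submodule.finiteDimensional_of_le (S₂ :=
          Submodule.span ℂ (Set.range fun u : ZG G => rAct (u : UC (lieAlg G)) f))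
          (Submodule.span_le.2 ?_)
        rintro _ ⟨k, rfl⟩
        simp only [map_smul]
        exact Submodule.smul_mem _ c (Submodule.subset_span ⟨k, rfl⟩)
      growth := by
        obtain ⟨d, hd⟩ := h.growth
        refine ⟨d, fun u => ?_⟩
        obtain ⟨C, hC⟩ := hd u
        refine ⟨‖c‖ * C, fun x => ?_⟩
        rw [map_smul, mul_assoc]
        calc ‖c • (rAct u f : G → ℂ) x‖ = ‖c‖ * ‖(rAct u f : G → ℂ) x‖ := norm_smul _ _
          _ ≤ _ := by gcongr; exact hC x }

/-- `Sh(lam, ν)`, the space of Shintani functions of type `(lam, ν)` for the pair `G ⊃ G'`. -/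
noncomputable def Sh {G' : LinGrp n} (hle : G' ≤ G) {𝔧 : LieSubalgebra ℝ (lieAlg G)}
    {𝔧' : LieSubalgebra ℝ (lieAlg G')} (lam : Module.Dual ℂ (Cplx 𝔧))
    (ν : Module.Dual ℂ (Cplx 𝔧')) : Submodule ℂ (SmoothFn G ℂ) where
  carrier := {f |
    (∀ k' ∈ compactK G', ∀ k ∈ compactK G, ∀ g : G,
      (f : G → ℂ) (incl hle k' * g * k) = (f : G → ℂ) g) ∧
    (∀ u : ZG G, rAct (u : UC (lieAlg G)) f = chi 𝔧 lam u • f) ∧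
    (∀ v : ZG G', lAct (envMap (lieIncl hle) (v : UC (lieAlg G'))) f = chi 𝔧' ν v • f)}
  zero_mem' := ⟨fun _ _ _ _ _ => rfl, fun _ => by simp, fun _ => by simp⟩
  add_mem' {f₁ f₂} h₁ h₂ :=
    ⟨fun k' hk' k hk g => congrArg₂ (· + ·) (h₁.1 k' hk' k hk g) (h₂.1 k' hk' k hk g),
      fun u => by rw [map_add, h₁.2.1, h₂.2.1, smul_add],
      fun v => by rw [map_add, h₁.2.2, h₂.2.2, smul_add]⟩
  smul_mem' c f h :=
    ⟨fun k' hk' k hk g => congrArg (c • ·) (h.1 k' hk' k hk g),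
      fun u => by rw [map_smul, h.2.1, smul_comm],
      fun v => by rw [map_smul, h.2.2, smul_comm]⟩

/-- `Sh_mod(lam, ν)`, the space of Shintani functions of moderate growth. -/
noncomputable def ShMod {G' : LinGrp n} (hle : G' ≤ G) {𝔧 : LieSubalgebra ℝ (lieAlg G)}
    {𝔧' : LieSubalgebra ℝ (lieAlg G')} (lam : Module.Dual ℂ (Cplx 𝔧))
    (ν : Module.Dual ℂ (Cplx 𝔧')) : Submodule ℂ (SmoothFn G ℂ) :=
  Sh hle lam ν ⊓ ModerateGrowth G

end Shintani

open Shintani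

/-!
The map sends `T` to the matrix coefficient `F(g) = l(π(g) 1_π)` of the continuous linear form
`l = 1_{τ^∨} ∘ T` on `H^∞` (`matCoeff`).

By the Hahn-Banach theorem, `l` is a finite sum of forms `v ↦ ξ(dπ(u) v)` with `ξ` continuous on the
Banach space (`exists_form_eq_sum`). Since `dπ(u) π(g) = π(g) dπ(Ad(g⁻¹) u)`, and `Ad(g⁻¹) u` is a
finite sum `∑ j, c j (g) w j` with coefficients that are polynomial in the entries of `g` and `g⁻¹`
(`exists_isAdExpansion`), the function `F` is smooth and `R_u F` is the coefficient of `dπ(u) 1_π`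
(`rAct_matCoeff`). The same formula reduces the growth of `F` to that of `‖π(g)‖`. The latter is
bounded by a power of the norm of `g`, by the uniform boundedness principle and the Cartan
decomposition (`exists_norm_toHom_le_matSize`).

As `T` intertwines the actions of `𝔤'`, the operator `L_v` acts on `F` through the contragredient of
`τ`, on which `v` acts by `χ_{-ν}(ᵗv)`, where `v ↦ ᵗv` is the principal anti-automorphism. The latter
exchanges `𝔫⁺` and `𝔫⁻`. It therefore carries the condition that defines `χ_ν(v)` for a positive
system `Δ` to the one that defines `χ_{-ν}(ᵗv)` for `-Δ`, so that both numbers agree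
(`chi_neg_antipode`).

Suppose that `F = 0`. In the irreducible case, the vectors on whose orbit a continuous form vanishes
form a closed invariant subspace; applying this to `l` and then to `1_{τ^∨}` gives `T = 0`. In the
cyclic case, `l` vanishes on `U(𝔤_ℂ) 1_π = π_K`. This space is dense (`form_eq_zero_of_isKFinite`),
so `l = 0`. Then all forms in `U(𝔤'_ℂ) 1_{τ^∨}`, that is, all `K'`-finite forms, vanish on the image
of `T`, and these separate points (`eq_zero_of_isKFiniteForm`). Density and separation follow from
Gårding vectors `∫ P(g) b(ᵗg g) π(g) v dg` with `b` a bump function at the identity and `P` running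
through an algebra that contains the polynomials in the matrix entries. They are `K`-finite because
`b(ᵗg g)` is invariant under `K` on the left and the translates of `P` span a space of finite
dimension; there are enough of them by the Stone-Weierstrass theorem.
-/

namespace Shintani

/-! ### The enveloping algebra and its principal anti-automorphism -/

section Enveloping

variable {L : Type*} [LieRing L] [LieAlgebra ℝ L]

theorem envHom_ext {A : Type*} [Ring A] [Algebra ℂ A] {f g : UC L →ₐ[ℂ] A}
    (h : ∀ x, f (envι L x) = g (envι L x)) : f = g := by
  refine UniversalEnvelopingAlgebra.hom_ext ℂ (LieHom.ext fun x => ?_)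
  change f (UniversalEnvelopingAlgebra.ι ℂ x) = g (UniversalEnvelopingAlgebra.ι ℂ x)
  induction x using TensorProduct.induction_on with
  | zero => simp
  | add x y hx hy => simp only [map_add, hx, hy]
  | tmul a x =>
    have e : a ⊗ₜ[ℝ] x = a • ((1 : ℂ) ⊗ₜ[ℝ] x) := by simp [TensorProduct.smul_tmul']
    rw [e, map_smul, map_smul, map_smul]
    exact congrArg (a • ·) (h x)

/-- `U(L ⊗ ℂ)` is generated as an algebra by `L`. -/
theorem env_induction {P : UC L → Prop} (hc : ∀ a : ℂ, P (algebraMap ℂ _ a))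
    (hι : ∀ x, P (envι L x)) (hadd : ∀ u v, P u → P v → P (u + v))
    (hmul : ∀ u v, P u → P v → P (u * v)) (u : UC L) : P u := by
  let S : Subalgebra ℂ (UC L) :=
    { carrier := {u | P u}
      add_mem' := fun {u v} hu hv => hadd u v hu hv
      mul_mem' := fun {u v} hu hv => hmul u v hu hv
      algebraMap_mem' := hc }
  let j : L →ₗ[ℝ] S :=
    { toFun := fun x => ⟨envι L x, hι x⟩
      map_add' := fun x y => Subtype.ext (map_add _ x y)
      map_smul' := fun c x => Subtype.ext (map_smul (envι L) c x) }
  let φ : UC L →ₐ[ℂ] S := envLift j fun x y => Subtype.ext (envι_lie x y)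
  have h : S.val.comp φ = AlgHom.id ℂ _ := envHom_ext fun x => by
    change ((φ (envι L x) : S) : UC L) = envι L x
    rw [envLift_envι]; rfl
  have := AlgHom.congr_fun h u
  rw [← AlgHom.id_apply (R := ℂ) u, ← this]
  exact (φ u).2

theorem envMap_envι {L' : Type*} [LieRing L'] [LieAlgebra ℝ L'] (φ : L →ₗ⁅ℝ⁆ L') (x : L) :
    envMap φ (envι L x) = envι L' (φ x) := envLift_envι _ _ _

/-- The principal anti-automorphism `u ↦ ᵗu` of `U(L ⊗ ℂ)`, which is `-1` on `L`, as a
homomorphism to the opposite algebra. -/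
noncomputable def antipodeOp (L : Type*) [LieRing L] [LieAlgebra ℝ L] : UC L →ₐ[ℂ] (UC L)ᵐᵒᵖ :=
  envLift (-((MulOpposite.opLinearEquiv ℝ).toLinearMap ∘ₗ envι L)) fun x y => by
    simp only [LinearMap.neg_apply, LinearMap.comp_apply, LinearEquiv.coe_coe,
      MulOpposite.coe_opLinearEquiv, envι_lie, MulOpposite.op_sub, MulOpposite.op_mul, neg_mul_neg]
    abel

/-- The principal anti-automorphism of `U(L ⊗ ℂ)` as a linear map. -/
noncomputable def antipode (L : Type*) [LieRing L] [LieAlgebra ℝ L] : UC L →ₗ[ℂ] UC L :=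
  (MulOpposite.opLinearEquiv ℂ).symm.toLinearMap ∘ₗ (antipodeOp L).toLinearMap

theorem antipode_mul (u v : UC L) : antipode L (u * v) = antipode L v * antipode L u := by
  simp [antipode]

theorem antipode_algebraMap (a : ℂ) : antipode L (algebraMap ℂ _ a) = algebraMap ℂ _ a := by
  simp [antipode]

theorem antipode_envι (x : L) : antipode L (envι L x) = -envι L x := by
  simp only [antipode, LinearMap.comp_apply, AlgHom.toLinearMap_apply, antipodeOp, envLift_envι]
  simp

theorem antipode_ι (x : ℂ ⊗[ℝ] L) : antipode L (UniversalEnvelopingAlgebra.ι ℂ x) =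
    -UniversalEnvelopingAlgebra.ι ℂ x := by
  induction x using TensorProduct.induction_on with
  | zero => simp
  | add x y hx hy => simp only [map_add, hx, hy, neg_add]
  | tmul a x =>
    have e : a ⊗ₜ[ℝ] x = a • ((1 : ℂ) ⊗ₜ[ℝ] x) := by simp [TensorProduct.smul_tmul']
    rw [e, map_smul, map_smul, ← envι_apply, antipode_envι, smul_neg]

theorem antipode_antipode (u : UC L) : antipode L (antipode L u) = u := by
  induction u using env_induction with
  | hc a => simp only [antipode_algebraMap]
  | hι x => simp only [antipode_envι, map_neg, neg_neg]
  | hadd u v hu hv => simp only [map_add, hu, hv]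
  | hmul u v hu hv => simp only [antipode_mul, hu, hv]

theorem envMap_antipode {L' : Type*} [LieRing L'] [LieAlgebra ℝ L'] (φ : L →ₗ⁅ℝ⁆ L') (u : UC L) :
    envMap φ (antipode L u) = antipode L' (envMap φ u) := by
  induction u using env_induction with
  | hc a => simp only [antipode_algebraMap, AlgHom.commutes]
  | hι x => simp only [antipode_envι, map_neg, envMap_envι]
  | hadd u v hu hv => simp only [map_add, hu, hv]
  | hmul u v hu hv => simp only [antipode_mul, map_mul, hu, hv]

end Enveloping

/-! ### Infinitesimal characters and the principal anti-automorphism -/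

section HarishChandra

variable {𝔤 : Type*} [LieRing 𝔤] [LieAlgebra ℝ 𝔤] {𝔧 : LieSubalgebra ℝ 𝔤}

open Classical in
theorem IsPositiveSystem.neg {Δ : Finset (Module.Dual ℂ (Cplx 𝔧))} (h : IsPositiveSystem 𝔧 Δ) :
    IsPositiveSystem 𝔧 (Δ.image Neg.neg) := by
  have hm : ∀ α, α ∈ Δ.image Neg.neg ↔ -α ∈ Δ := fun α => by
    rw [Finset.mem_image]
    exact ⟨by rintro ⟨β, hβ, rfl⟩; rwa [neg_neg], fun h => ⟨-α, h, neg_neg α⟩⟩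
  refine ⟨fun α => ?_, fun α hα => ?_, fun α hα β hβ hr => ?_⟩
  · rw [h.isRoot_iff, hm, hm, neg_neg, or_comm]
  · rw [hm] at hα ⊢
    exact h.disjoint _ hα
  · rw [hm] at hα hβ ⊢
    rw [neg_add]
    refine h.add_mem _ hα _ hβ ?_
    rw [h.isRoot_iff] at hr ⊢
    rw [← neg_add, neg_neg]
    exact hr.symm

open Classical in
theorem rho_neg (Δ : Finset (Module.Dual ℂ (Cplx 𝔧))) :
    rho 𝔧 (Δ.image Neg.neg) = -rho 𝔧 Δ := by
  rw [rho, rho, Finset.sum_image (fun _ _ _ _ h => neg_injective h), Finset.sum_neg_distrib, smul_neg]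

open Classical in
theorem antipode_mem_nilpotentPart {Δ : Finset (Module.Dual ℂ (Cplx 𝔧))} {w : UC 𝔤}
    (hw : w ∈ nilpotentPart 𝔧 Δ) : antipode 𝔤 w ∈ nilpotentPart 𝔧 (Δ.image Neg.neg) := by
  have : nilpotentPart 𝔧 Δ ≤ (nilpotentPart 𝔧 (Δ.image Neg.neg)).comap (antipode 𝔤) := by
    refine sup_le (Submodule.span_le.2 ?_) (Submodule.span_le.2 ?_)
    · rintro _ ⟨α, hα, x, hx, u, rfl⟩
      refine Submodule.mem_sup_right (Submodule.subset_span
        ⟨-α, Finset.mem_image_of_mem _ hα, x, hx, -antipode 𝔤 u, ?_⟩)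
      simp only [antipode_mul, antipode_ι, mul_neg, neg_mul]
    · rintro _ ⟨α, hα, x, hx, u, rfl⟩
      refine Submodule.mem_sup_left (Submodule.subset_span
        ⟨-α, Finset.mem_image_of_mem _ hα, x, by rwa [neg_neg], -antipode 𝔤 u, ?_⟩)
      simp only [antipode_mul, antipode_ι, mul_neg, neg_mul]
  exact this hw

/-- A form `φ` on the commutative algebra `U(𝔧_ℂ)` composed with the principal anti-automorphism
is again multiplicative; this is evaluation at `-lam` if `φ` is evaluation at `lam`. -/
noncomputable def negEval (φ : UC 𝔧 →ₐ[ℂ] ℂ) : UC 𝔧 →ₐ[ℂ] ℂ :=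
  AlgHom.ofLinearMap (φ.toLinearMap ∘ₗ antipode 𝔧)
    (by
      have := antipode_algebraMap (L := 𝔧) 1
      rw [map_one] at this
      simp [this])
    fun u v => by simp [antipode_mul, mul_comm]

/-- The principal anti-automorphism exchanges `𝔫⁺` and `𝔫⁻`, hence `(Δ, lam)` and `(-Δ, -lam)`. -/
theorem IsHarishChandraValue.antipode {lam : Module.Dual ℂ (Cplx 𝔧)} {u : UC 𝔤} {c : ℂ}
    (h : IsHarishChandraValue 𝔧 lam u c) :
    IsHarishChandraValue 𝔧 (-lam) (Shintani.antipode 𝔤 u) c := by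
  classical
  intro Δ hΔ φ hφ p hp
  have := h (Δ.image Neg.neg) hΔ.neg (negEval φ) (fun H => ?_) (Shintani.antipode 𝔧 p) ?_
  · rw [this]
    change φ (Shintani.antipode 𝔧 (Shintani.antipode 𝔧 p)) = φ p
    rw [antipode_antipode]
  · change φ (Shintani.antipode 𝔧 _) = _
    rw [antipode_ι, map_neg, hφ, rho_neg]
    simp [add_comm]
  · rw [envMap_antipode, ← antipode_antipode u, ← map_sub]
    exact antipode_mem_nilpotentPart hp

theorem isHarishChandraValue_antipode_iff {lam : Module.Dual ℂ (Cplx 𝔧)} {u : UC 𝔤} {c : ℂ} :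
    IsHarishChandraValue 𝔧 (-lam) (antipode 𝔤 u) c ↔ IsHarishChandraValue 𝔧 lam u c :=
  ⟨fun h => by simpa only [neg_neg, antipode_antipode] using h.antipode, fun h => h.antipode⟩

end HarishChandra

variable {n : ℕ} {G : LinGrp n}

theorem antipode_mem_ZG {u : UC (lieAlg G)} (hu : u ∈ ZG G) : antipode _ u ∈ ZG G :=
  mem_ZG.2 fun g => by rw [envMap_antipode, mem_ZG.1 hu g]

/-- `χ_{-lam}(ᵗu) = χ_lam(u)`. -/
theorem chi_neg_antipode (𝔧 : LieSubalgebra ℝ (lieAlg G)) (lam : Module.Dual ℂ (Cplx 𝔧)) (u : ZG G) :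
    chi 𝔧 (-lam) ⟨antipode _ (u : UC (lieAlg G)), antipode_mem_ZG u.2⟩ = chi 𝔧 lam u := by
  simp only [chi, isHarishChandraValue_antipode_iff]

end Shintani

namespace Shintani

variable {n : ℕ} {G : LinGrp n} {E : Type*} [NormedAddCommGroup E] [NormedSpace ℂ E]

/-! ### Products of smooth functions -/

/-- The derivative that defines `R_X f` exists. -/
theorem hasDerivAt_mul_expG (X : lieAlg G) (f : SmoothFn G E) (g : G) :
    HasDerivAt (fun t : ℝ => (f : G → E) (g * expG (t • X))) ((rDeriv X f : G → E) g) 0 := by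
  obtain ⟨F, hF, e⟩ := f.2 g
  have h := ((isFlow_right X).hasDerivAt hF e).self_of_nhds
  rw [rDeriv_apply, h.deriv]
  exact h

/-- The derivative that defines `L_X f` exists. -/
theorem hasDerivAt_expG_neg_mul (X : lieAlg G) (f : SmoothFn G E) (g : G) :
    HasDerivAt (fun t : ℝ => (f : G → E) (expG ((-t) • X) * g)) ((lDeriv X f : G → E) g) 0 := by
  obtain ⟨F, hF, e⟩ := f.2 g
  have h := ((isFlow_left X).hasDerivAt hF e).self_of_nhds
  rw [lDeriv_apply, h.deriv]
  exact h

theorem continuous_smoothFn (f : SmoothFn G E) : Continuous (f : G → E) := by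
  refine continuous_iff_continuousAt.2 fun g => ?_
  obtain ⟨F, hF, e⟩ := f.2 g
  exact (ContinuousAt.comp (g := F) hF.continuousAt continuous_mat.continuousAt).congr
    (e.mono fun _ h => h.symm)

/-- The product of a smooth scalar function and a smooth vector valued function. -/
noncomputable def smoothSMul (c : SmoothFn G ℂ) (f : SmoothFn G E) : SmoothFn G E :=
  ⟨fun g => (c : G → ℂ) g • (f : G → E) g, fun g => by
    obtain ⟨F₁, hF₁, e₁⟩ := c.2 g
    obtain ⟨F₂, hF₂, e₂⟩ := f.2 g
    refine ⟨fun x => F₁ x • F₂ x, hF₁.smul hF₂, ?_⟩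
    filter_upwards [e₁, e₂] with h i₁ i₂
    rw [i₁, i₂]⟩

theorem smoothSMul_apply (c : SmoothFn G ℂ) (f : SmoothFn G E) (g : G) :
    (smoothSMul c f : G → E) g = (c : G → ℂ) g • (f : G → E) g := rfl

theorem rDeriv_smoothSMul (X : lieAlg G) (c : SmoothFn G ℂ) (f : SmoothFn G E) (g : G) :
    (rDeriv X (smoothSMul c f) : G → E) g =
      (c : G → ℂ) g • (rDeriv X f : G → E) g + (rDeriv X c : G → ℂ) g • (f : G → E) g := by
  have h := (hasDerivAt_mul_expG X c g).fun_smul (hasDerivAt_mul_expG X f g)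
  have e : g * expG ((0 : ℝ) • X) = g := by simp only [expG_smul, oneParam_zero, mul_one]
  rw [e] at h
  exact (hasDerivAt_mul_expG X (smoothSMul c f) g).unique h

/-- A continuous linear map applied to a smooth function. -/
noncomputable def smoothMap {E' : Type*} [NormedAddCommGroup E'] [NormedSpace ℂ E']
    (A : E →L[ℂ] E') (f : SmoothFn G E) : SmoothFn G E' :=
  ⟨fun g => A ((f : G → E) g), fun g => by
    obtain ⟨F, hF, e⟩ := f.2 g
    refine ⟨fun x => A (F x), ?_, e.mono fun h i => congrArg A i⟩
    exact (A.restrictScalars ℝ).contDiff.contDiffAt.comp (mat g) hF⟩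

/-- Constant functions. -/
noncomputable def smoothConst (G : LinGrp n) (a : E) : SmoothFn G E :=
  ⟨fun _ => a, fun _ => ⟨fun _ => a, contDiffAt_const, Filter.Eventually.of_forall fun _ => rfl⟩⟩

theorem rDeriv_smoothConst (X : lieAlg G) (a : E) (g : G) :
    (rDeriv X (smoothConst G a) : G → E) g = 0 :=
  (hasDerivAt_mul_expG X (smoothConst G a) g).unique (hasDerivAt_const _ _)

/-! ### The adjoint action on the enveloping algebra -/

theorem expG_Ad (g : G) (X : lieAlg G) : expG (Ad g X) = g * expG X * g⁻¹ := by
  apply mat_injective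
  rw [mat_expG, mat_mul, mat_mul, mat_expG]
  let _ : NormedAlgebra ℚ (Mat n) := NormedAlgebra.restrictScalars ℚ ℝ (Mat n)
  exact NormedSpace.exp_units_conj ((g : GL (Fin n) ℝ)) (X : Mat n)

theorem expG_zero : expG (0 : lieAlg G) = 1 := by
  have := expG_smul (0 : lieAlg G) 0
  rwa [oneParam_zero, smul_zero] at this

theorem expG_neg (X : lieAlg G) : expG (-X) = (expG X)⁻¹ := by
  refine eq_inv_of_mul_eq_one_left (mat_injective ?_)
  rw [mat_mul, mat_expG, mat_expG, mat_one]
  let _ : NormedAlgebra ℚ (Mat n) := NormedAlgebra.restrictScalars ℚ ℝ (Mat n)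
  change NormedSpace.exp (-(X : Mat n)) * _ = 1
  rw [← NormedSpace.exp_add_of_commute (Commute.refl (X : Mat n)).neg_left]
  simp

section Rep

variable {H : Type*} [NormedAddCommGroup H] [NormedSpace ℂ H] {π : BanachRep G H}

theorem hasDerivAt_toHom_expG (X : lieAlg G) (v : SmoothVec π) :
    HasDerivAt (fun t : ℝ => π.toHom (expG (t • X)) v.val) (dActX X v).val 0 := by
  have := hasDerivAt_mul_expG X (orbit v) 1
  simp only [one_mul] at this
  exact this

theorem dAct_envι (X : lieAlg G) : dAct π (envι _ X) = dActX X := envLift_envι _ _ _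

/-- `dπ(X) π(g) = π(g) dπ(Ad(g⁻¹) X)`. -/
theorem dActX_smoothRep (X : lieAlg G) (g : G) (v : SmoothVec π) :
    dActX X (smoothRep π g v) = smoothRep π g (dActX (Ad g⁻¹ X) v) := by
  refine SmoothVec.val_injective ((hasDerivAt_toHom_expG X (smoothRep π g v)).unique ?_)
  have h := ((π.toHom g).restrictScalars ℝ).hasFDerivAt.comp_hasDerivAt 0
    (hasDerivAt_toHom_expG (Ad g⁻¹ X) v)
  refine h.congr_of_eventuallyEq (Filter.Eventually.of_forall fun t => ?_)
  have e : expG (t • X) * g = g * expG (t • Ad g⁻¹ X) := by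
    rw [← map_smul, expG_Ad]; group
  change π.toHom (expG (t • X)) (π.toHom g v.val) = π.toHom g (π.toHom _ v.val)
  rw [← mul_apply_eq_comp, ← map_mul, e, map_mul, mul_apply_eq_comp]

/-- `dπ(u) π(g) = π(g) dπ(Ad(g⁻¹) u)`. -/
theorem dAct_smoothRep (u : UC (lieAlg G)) (g : G) (v : SmoothVec π) :
    dAct π u (smoothRep π g v) = smoothRep π g (dAct π (envMap (Ad g⁻¹) u) v) := by
  induction u using env_induction generalizing v with
  | hc a => simp only [AlgHom.commutes, Module.algebraMap_end_apply, map_smul]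
  | hι X => rw [envMap_envι, dAct_envι, dAct_envι, dActX_smoothRep]
  | hadd u v hu hv => simp only [map_add, LinearMap.add_apply, hu, hv]
  | hmul u v hu hv => simp only [map_mul, Module.End.mul_apply, hu, hv]

end Rep

/-- A size function on `G` that is comparable to `groupNorm` for `n > 0`. Unlike `groupNorm`, it is
at least `1` also for `n = 0`. -/
noncomputable def matSize (g : G) : ℝ := 1 + ‖mat g‖ + ‖mat g⁻¹‖

theorem one_le_matSize (g : G) : 1 ≤ matSize g := by
  have := norm_nonneg (mat g)
  have := norm_nonneg (mat g⁻¹)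
  simp only [matSize]; linarith

theorem norm_mat_le_matSize (g : G) : ‖mat g‖ ≤ matSize g := by
  have := norm_nonneg (mat g⁻¹); simp only [matSize]; linarith

theorem norm_mat_inv_le_matSize (g : G) : ‖mat g⁻¹‖ ≤ matSize g := by
  have := norm_nonneg (mat g); simp only [matSize]; linarith

/-- An expansion `Ad(g⁻¹) u = ∑ j, c j (g) w j` with smooth coefficients of polynomial growth.
The last condition is the derivative of this expansion at the identity. -/
structure IsAdExpansion {ι : Type} [Fintype ι] (u : UC (lieAlg G)) (c : ι → SmoothFn G ℂ)
    (w : ι → UC (lieAlg G)) : Prop where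
  expand : ∀ g, envMap (Ad g⁻¹) u = ∑ j, (c j : G → ℂ) g • w j
  growth : ∀ j, ∃ (C : ℝ) (d : ℕ), ∀ g, ‖(c j : G → ℂ) g‖ ≤ C * matSize g ^ d
  deriv : ∀ X, ∑ j, (rDeriv X (c j) : G → ℂ) 1 • w j = u * envι _ X - envι _ X * u

theorem Ad_one (u : UC (lieAlg G)) : envMap (Ad (1 : G)) u = u := by
  have : envMap (Ad (1 : G)) = AlgHom.id ℂ _ := envHom_ext fun X => by
    rw [envMap_envι, AlgHom.id_apply]
    congr 1
    exact Subtype.ext (by simp [Ad, mat_one])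
  rw [this, AlgHom.id_apply]

theorem IsAdExpansion.expand_one {ι : Type} [Fintype ι] {u : UC (lieAlg G)}
    {c : ι → SmoothFn G ℂ} {w : ι → UC (lieAlg G)} (h : IsAdExpansion u c w) :
    u = ∑ j, (c j : G → ℂ) 1 • w j := by
  have := h.expand 1
  rwa [inv_one, Ad_one] at this

/-- The coefficient `g ↦ l(g⁻¹ X g)` of the adjoint action. -/
noncomputable def adCoeff (l : Mat n →ₗ[ℝ] ℝ) (X : Mat n) : SmoothFn G ℂ :=
  ⟨fun g => ((l (mat g⁻¹ * X * mat g) : ℝ) : ℂ), fun g => by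
    refine ⟨fun x => ((l (Ring.inverse x * X * x) : ℝ) : ℂ), ?_,
      Filter.Eventually.of_forall fun h => ?_⟩
    · have h1 : ContDiffAt ℝ ∞ (fun x : Mat n => Ring.inverse x * X * x) (mat g) :=
        ((contDiffAt_ringInverse ℝ (g : GL (Fin n) ℝ)).mul contDiffAt_const).mul contDiffAt_id
      exact (Complex.ofRealCLM.contDiff.comp
        (LinearMap.toContinuousLinearMap l).contDiff).contDiffAt.comp (mat g) h1
    · have : Ring.inverse (mat h) = mat h⁻¹ := Ring.inverse_unit (h : GL (Fin n) ℝ)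
      simp only [this]⟩

theorem adCoeff_apply (l : Mat n →ₗ[ℝ] ℝ) (X : Mat n) (g : G) :
    (adCoeff (G := G) l X : G → ℂ) g = ((l (mat g⁻¹ * X * mat g) : ℝ) : ℂ) := rfl

theorem norm_adCoeff_le (l : Mat n →ₗ[ℝ] ℝ) (X : Mat n) (g : G) :
    ‖(adCoeff (G := G) l X : G → ℂ) g‖ ≤ ‖LinearMap.toContinuousLinearMap l‖ * ‖X‖ * matSize g ^ 2 := by
  rw [adCoeff_apply, Complex.norm_real]
  have h1 := norm_mat_le_matSize g
  have h2 := norm_mat_inv_le_matSize g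
  have h0 : 0 ≤ matSize g := zero_le_one.trans (one_le_matSize g)
  calc ‖l (mat g⁻¹ * X * mat g)‖
      ≤ ‖LinearMap.toContinuousLinearMap l‖ * ‖mat g⁻¹ * X * mat g‖ :=
        (LinearMap.toContinuousLinearMap l).le_opNorm _
    _ ≤ ‖LinearMap.toContinuousLinearMap l‖ * (‖mat g⁻¹‖ * ‖X‖ * ‖mat g‖) := by
        gcongr
        exact (norm_mul_le _ _).trans (by gcongr; exact norm_mul_le _ _)
    _ ≤ ‖LinearMap.toContinuousLinearMap l‖ * (matSize g * ‖X‖ * matSize g) := by gcongr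
    _ = _ := by ring

theorem rDeriv_adCoeff (l : Mat n →ₗ[ℝ] ℝ) (X : Mat n) (Y : lieAlg G) :
    (rDeriv Y (adCoeff l X) : G → ℂ) 1 = ((l (X * Y - Y * X) : ℝ) : ℂ) := by
  refine (hasDerivAt_mul_expG Y (adCoeff l X) 1).unique ?_
  have h : HasDerivAt (fun t : ℝ => mat (expG (t • Y))⁻¹ * X * mat (expG (t • Y)))
      (X * Y - Y * X) 0 := by
    have h1 : HasDerivAt (fun t : ℝ => mat (expG (t • Y))) (Y : Mat n) 0 := by
      simp only [expG_smul]; exact hasDerivAt_mat_oneParam _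
    have h2 : HasDerivAt (fun t : ℝ => mat (expG (t • Y))⁻¹) (-(Y : Mat n)) 0 := by
      have : ∀ t : ℝ, (expG (t • Y))⁻¹ = expG (t • (-Y)) := fun t => by
        rw [← expG_neg, smul_neg]
      simp only [this]; simp only [expG_smul]; exact hasDerivAt_mat_oneParam (coe_mem_expSet (-Y))
    have h3 := (h2.mul_const X).mul h1
    simp only [zero_smul, expG_zero, inv_one, mat_one, mul_one, one_mul] at h3
    rw [show X * Y - Y * X = -(Y : Mat n) * X + X * Y by noncomm_ring]
    exact h3
  have := ((Complex.ofRealCLM.comp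
    (LinearMap.toContinuousLinearMap l)).hasFDerivAt).comp_hasDerivAt (0 : ℝ) h
  simp only [one_mul, adCoeff_apply]
  exact this

theorem exists_isAdExpansion_envι (X : lieAlg G) :
    ∃ (ι : Type) (_ : Fintype ι) (c : ι → SmoothFn G ℂ) (w : ι → UC (lieAlg G)),
      IsAdExpansion (envι _ X) c w := by
  let b := Module.finBasis ℝ (lieAlg G)
  have hl : ∀ j, ∃ l : Mat n →ₗ[ℝ] ℝ, ∀ Y : lieAlg G, l (Y : Mat n) = b.coord j Y := fun j => by
    obtain ⟨l, hl⟩ := LinearMap.exists_extend (p := (lieAlg G).toSubmodule) (b.coord j)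
    exact ⟨l, fun Y => LinearMap.congr_fun hl Y⟩
  choose l hl using hl
  have hs : ∀ Y : lieAlg G, envι _ Y = ∑ j, ((l j (Y : Mat n) : ℝ) : ℂ) • envι _ (b j) := fun Y => by
    conv_lhs => rw [← b.sum_repr Y]
    simp only [map_sum, map_smul, hl, Module.Basis.coord_apply]
    rfl
  refine ⟨_, inferInstance, fun j => adCoeff (l j) X, fun j => envι _ (b j),
    fun g => ?_, fun j => ⟨_, 2, norm_adCoeff_le (l j) X⟩, fun Y => ?_⟩
  · rw [envMap_envι, hs]
    simp only [adCoeff_apply]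
    have : ((Ad g⁻¹ X : lieAlg G) : Mat n) = mat g⁻¹ * X * mat g := by
      simp [Ad]
    rw [this]
  · simp only [rDeriv_adCoeff]
    rw [← envι_lie, hs]
    rfl

/-- The adjoint action on `U(𝔤_ℂ)` is locally finite, with matrix coefficients that are polynomial
in the entries of `g` and `g⁻¹`. -/
theorem exists_isAdExpansion (u : UC (lieAlg G)) :
    ∃ (ι : Type) (_ : Fintype ι) (c : ι → SmoothFn G ℂ) (w : ι → UC (lieAlg G)),
      IsAdExpansion u c w := by
  induction u using env_induction with
  | hc a =>
    refine ⟨Unit, inferInstance, fun _ => smoothConst G a, fun _ => 1, fun g => ?_,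
      fun _ => ⟨‖a‖, 0, fun g => by simp [smoothConst]⟩, fun X => ?_⟩
    · simp [smoothConst, Algebra.algebraMap_eq_smul_one]
    · simp [rDeriv_smoothConst, Algebra.commutes]
  | hι X => exact exists_isAdExpansion_envι X
  | hadd u v hu hv =>
    obtain ⟨ι, _, c, w, h⟩ := hu
    obtain ⟨ι', _, c', w', h'⟩ := hv
    refine ⟨ι ⊕ ι', inferInstance, Sum.elim c c', Sum.elim w w', fun g => ?_, ?_, fun X => ?_⟩
    · simp [h.expand, h'.expand]
    · rintro (j | j)
      exacts [h.growth j, h'.growth j]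
    · simp only [Fintype.sum_sum_type, Sum.elim_inl, Sum.elim_inr, h.deriv, h'.deriv]
      noncomm_ring
  | hmul u v hu hv =>
    obtain ⟨ι, _, c, w, h⟩ := hu
    obtain ⟨ι', _, c', w', h'⟩ := hv
    refine ⟨ι × ι', inferInstance, fun p => smoothSMul (c p.1) (c' p.2), fun p => w p.1 * w' p.2,
      fun g => ?_, ?_, fun X => ?_⟩
    · simp only [map_mul, h.expand, h'.expand, Fintype.sum_prod_type, Finset.sum_mul_sum,
        smoothSMul_apply, smul_mul_smul_comm, smul_eq_mul]
    · rintro ⟨j, j'⟩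
      obtain ⟨C, d, hC⟩ := h.growth j
      obtain ⟨C', d', hC'⟩ := h'.growth j'
      refine ⟨C * C', d + d', fun g => ?_⟩
      rw [smoothSMul_apply, norm_smul]
      calc _ ≤ (C * matSize g ^ d) * (C' * matSize g ^ d') :=
            mul_le_mul (hC g) (hC' g) (norm_nonneg _) ((norm_nonneg _).trans (hC g))
        _ = _ := by ring
    · have e : u * v * envι _ X - envι _ X * (u * v) =
          u * (v * envι _ X - envι _ X * v) + (u * envι _ X - envι _ X * u) * v := by noncomm_ring
      rw [e, ← h.deriv, ← h'.deriv]
      conv_rhs => rw [h.expand_one]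
      rw [Finset.sum_mul_sum]
      conv_rhs => enter [2, 2]; rw [h'.expand_one]
      rw [Finset.sum_mul_sum, ← Finset.sum_add_distrib, Fintype.sum_prod_type]
      refine Finset.sum_congr rfl fun j _ => ?_
      rw [← Finset.sum_add_distrib]
      refine Finset.sum_congr rfl fun j' _ => ?_
      rw [rDeriv_smoothSMul, smul_mul_smul_comm, smul_mul_smul_comm, ← add_smul]
      simp only [smul_eq_mul]

end Shintani

namespace Shintani

variable {n : ℕ} {G : LinGrp n} {H : Type*} [NormedAddCommGroup H] [NormedSpace ℂ H]
  {π : BanachRep G H}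

/-! ### Continuous linear forms on smooth vectors -/

theorem continuous_val_dAct (u : UC (lieAlg G)) :
    Continuous fun v : SmoothVec π => (dAct π u v).val :=
  continuous_iInf_dom (i := u) continuous_induced_dom

/-- The inclusion of `H^∞` in `H` as a continuous linear map. -/
noncomputable def valL : SmoothVec π →L[ℂ] H where
  toLinearMap := SmoothVec.val
  cont := by
    have := continuous_val_dAct (π := π) 1
    simpa using this

/-- A continuous linear form is bounded by finitely many of the seminorms of `H^∞`. -/
theorem exists_bound_form (l : SmoothVec π →L[ℂ] ℂ) :
    ∃ (s : Finset (UC (lieAlg G))) (C : ℝ), ∀ v, ‖l v‖ ≤ C * ∑ u ∈ s, ‖(dAct π u v).val‖ := by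
  classical
  have hp := fun u : UC (lieAlg G) => LinearMap.withSeminorms_induced (norm_withSeminorms ℂ H)
    (SmoothVec.val ∘ₗ dAct π u : SmoothVec π →ₗ[ℂ] H)
  obtain ⟨s, C, -, h⟩ := Seminorm.bound_of_continuous (withSeminorms_iInf hp)
    ((normSeminorm ℂ ℂ).comp (l : SmoothVec π →ₗ[ℂ] ℂ)) l.continuous.norm
  refine ⟨s.image Sigma.fst, C, fun v => (h v).trans ?_⟩
  change (C : ℝ) * _ ≤ _
  refine mul_le_mul_of_nonneg_left (Seminorm.finset_sup_apply_le (by positivity) fun i hi => ?_)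
    C.2
  exact Finset.single_le_sum (f := fun u => ‖(dAct π u v).val‖) (fun _ _ => norm_nonneg _)
    (Finset.mem_image_of_mem _ hi)

/-- By the Hahn-Banach theorem, a continuous linear form on `H^∞` is a finite sum of forms
`v ↦ ξ (dπ(u) v)` with `ξ` a continuous linear form on `H`. -/
theorem exists_form_eq_sum (l : SmoothVec π →L[ℂ] ℂ) :
    ∃ (s : Finset (UC (lieAlg G))) (ξ : s → H →L[ℂ] ℂ),
      ∀ v, l v = ∑ u : s, ξ u (dAct π (u : UC (lieAlg G)) v).val := by
  classical
  obtain ⟨s, C, hC⟩ := exists_bound_form l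
  let J : SmoothVec π →ₗ[ℂ] (s → H) :=
    LinearMap.pi fun u => SmoothVec.val ∘ₗ dAct π (u : UC (lieAlg G))
  obtain ⟨σ, hσ⟩ := J.rangeRestrict.exists_rightInverse_of_surjective J.range_rangeRestrict
  have hJσ : ∀ y, J (σ y) = y := fun y => congrArg Subtype.val (LinearMap.congr_fun hσ y)
  have hb : ∀ v, ‖l v‖ ≤ (|C| * s.card) * ‖J v‖ := fun v => by
    refine (hC v).trans ?_
    have : ∑ u ∈ s, ‖(dAct π u v).val‖ ≤ s.card * ‖J v‖ := by
      rw [← nsmul_eq_mul]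
      exact Finset.sum_le_card_nsmul _ _ _ fun u hu => norm_le_pi_norm (J v) ⟨u, hu⟩
    rw [mul_assoc]
    exact mul_le_mul (le_abs_self C) this (Finset.sum_nonneg fun _ _ => norm_nonneg _)
      (abs_nonneg C)
  let f : LinearMap.range J →L[ℂ] ℂ := ((l : SmoothVec π →ₗ[ℂ] ℂ) ∘ₗ σ).mkContinuous
    (|C| * s.card) fun y => by
      have := hb (σ y)
      rwa [hJσ] at this
  obtain ⟨F, hF, -⟩ := exists_extension_norm_eq _ f
  refine ⟨s, fun u => F.comp (ContinuousLinearMap.single ℂ (fun _ : s => H) u), fun v => ?_⟩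
  have h1 : l v = f ⟨J v, v, rfl⟩ := by
    have h := hb (v - σ ⟨J v, v, rfl⟩)
    rw [map_sub J, hJσ, sub_self, norm_zero, mul_zero, norm_le_zero_iff, map_sub, sub_eq_zero] at h
    exact h
  rw [h1, ← hF]
  change F (J v) = _
  conv_lhs => rw [← LinearMap.sum_single_apply (fun _ : s => H) (J v)]
  rw [map_sum]
  rfl

/-- The map `g ↦ dπ(u) π(g) v` to `H` is smooth, by `dπ(u) π(g) = π(g) dπ(Ad(g⁻¹) u)` and the
expansion of `Ad(g⁻¹) u`. The second statement is `dπ(u)` applied to the derivative of `π(exp(tX)) v`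
at `t = 0`, that is, `π(exp(tX)) v` is differentiable also for the seminorm given by `u`. -/
theorem exists_smooth_dAct (u : UC (lieAlg G)) (v : SmoothVec π) :
    ∃ f : SmoothFn G H, (∀ g, (f : G → H) g = (dAct π u (smoothRep π g v)).val) ∧
      ∀ X, (rDeriv X f : G → H) 1 = (dAct π u (dActX X v)).val := by
  obtain ⟨ι, _, c, w, h⟩ := exists_isAdExpansion u
  refine ⟨∑ j, smoothSMul (c j) (orbit (dAct π (w j) v)), fun g => ?_, fun X => ?_⟩
  · rw [dAct_smoothRep, h.expand, val_smoothRep]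
    simp [smoothSMul_apply, orbit_apply, map_sum, LinearMap.sum_apply]
  · have e : u * envι _ X = envι _ X * u + ∑ j, (rDeriv X (c j) : G → ℂ) 1 • w j := by
      rw [h.deriv]; abel
    rw [← dAct_envι, ← Module.End.mul_apply, ← map_mul, e]
    conv_rhs => rw [h.expand_one]
    rw [map_sum, Submodule.coe_sum, Finset.sum_apply]
    simp only [rDeriv_smoothSMul, Finset.sum_add_distrib, orbit_one, map_add, LinearMap.add_apply,
      map_mul, Module.End.mul_apply, map_sum, LinearMap.sum_apply, map_smul, LinearMap.smul_apply,
      dAct_envι, val_dActX]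

theorem continuous_smoothRep (g : G) : Continuous (smoothRep π g) := by
  refine continuous_iInf_rng.2 fun u => continuous_induced_rng.2 ?_
  have h : (fun v => (dAct π u v).val) ∘ smoothRep π g =
      fun v => π.toHom g (dAct π (envMap (Ad g⁻¹) u) v).val := by
    ext v
    rw [Function.comp_apply, dAct_smoothRep, val_smoothRep]
  rw [h]
  exact (π.toHom g).continuous.comp (continuous_val_dAct _)

/-- `π^∞(g)` as a continuous linear map. -/
noncomputable def smoothRepL (π : BanachRep G H) (g : G) : SmoothVec π →L[ℂ] SmoothVec π where
  toLinearMap := smoothRep π g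
  cont := continuous_smoothRep g

/-- The matrix coefficient `g ↦ l(π(g) v)` of a smooth vector and a continuous linear form on
`H^∞`. -/
noncomputable def matCoeff (l : SmoothVec π →L[ℂ] ℂ) (v : SmoothVec π) : SmoothFn G ℂ :=
  ⟨fun g => l (smoothRep π g v), by
    obtain ⟨s, ξ, hl⟩ := exists_form_eq_sum l
    choose f hf _ using fun u : s => exists_smooth_dAct (π := π) (u : UC (lieAlg G)) v
    have : (fun g => l (smoothRep π g v)) =
        ((∑ u, smoothMap (ξ u) (f u) : SmoothFn G ℂ) : G → ℂ) := by
      ext g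
      rw [hl, Submodule.coe_sum, Finset.sum_apply]
      exact Finset.sum_congr rfl fun u _ => congrArg (ξ u) (hf u g).symm
    rw [this]
    exact (∑ u, smoothMap (ξ u) (f u) : SmoothFn G ℂ).2⟩

theorem matCoeff_apply (l : SmoothVec π →L[ℂ] ℂ) (v : SmoothVec π) (g : G) :
    (matCoeff l v : G → ℂ) g = l (smoothRep π g v) := rfl

/-- `t ↦ π(exp(tX)) v` is differentiable for the topology of `H^∞`, tested on linear forms. -/
theorem hasDerivAt_form (l : SmoothVec π →L[ℂ] ℂ) (v : SmoothVec π) (X : lieAlg G) :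
    HasDerivAt (fun t : ℝ => l (smoothRep π (expG (t • X)) v)) (l (dActX X v)) 0 := by
  obtain ⟨s, ξ, hl⟩ := exists_form_eq_sum l
  choose f hf hf' using fun u : s => exists_smooth_dAct (π := π) (u : UC (lieAlg G)) v
  simp only [hl]
  refine HasDerivAt.fun_sum fun u _ => ?_
  have h := ((ξ u).restrictScalars ℝ).hasFDerivAt.comp_hasDerivAt (0 : ℝ)
    (hasDerivAt_mul_expG X (f u) 1)
  rw [hf'] at h
  simp only [Function.comp_def, one_mul, hf] at h
  exact h

theorem rDeriv_matCoeff (l : SmoothVec π →L[ℂ] ℂ) (v : SmoothVec π) (X : lieAlg G) :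
    rDeriv X (matCoeff l v) = matCoeff l (dActX X v) := by
  ext g
  refine (hasDerivAt_mul_expG X (matCoeff l v) g).unique ?_
  have h := hasDerivAt_form (l.comp (smoothRepL π g)) v X
  refine h.congr_of_eventuallyEq (Filter.Eventually.of_forall fun t => ?_)
  change l (smoothRep π (g * expG (t • X)) v) = l (smoothRep π g (smoothRep π (expG (t • X)) v))
  rw [map_mul, Module.End.mul_apply]

theorem matCoeff_add (l : SmoothVec π →L[ℂ] ℂ) (v w : SmoothVec π) :
    matCoeff l (v + w) = matCoeff l v + matCoeff l w := by
  ext g; simp [matCoeff_apply]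

theorem matCoeff_smul (l : SmoothVec π →L[ℂ] ℂ) (a : ℂ) (v : SmoothVec π) :
    matCoeff l (a • v) = a • matCoeff l v := by
  ext g; simp [matCoeff_apply]

theorem matCoeff_add_left (l m : SmoothVec π →L[ℂ] ℂ) (v : SmoothVec π) :
    matCoeff (l + m) v = matCoeff l v + matCoeff m v := rfl

theorem matCoeff_smul_left (l : SmoothVec π →L[ℂ] ℂ) (a : ℂ) (v : SmoothVec π) :
    matCoeff (a • l) v = a • matCoeff l v := rfl

theorem rAct_matCoeff (l : SmoothVec π →L[ℂ] ℂ) (v : SmoothVec π) (u : UC (lieAlg G)) :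
    rAct u (matCoeff l v) = matCoeff l (dAct π u v) := by
  induction u using env_induction generalizing v with
  | hc a => simp only [AlgHom.commutes, Module.algebraMap_end_apply, matCoeff_smul]
  | hι X => rw [rAct_ι, dAct_envι, rDeriv_matCoeff]
  | hadd u w hu hw => simp only [map_add, LinearMap.add_apply, hu, hw, matCoeff_add]
  | hmul u w hu hw => simp only [map_mul, Module.End.mul_apply, hu, hw]

/-! ### The contragredient action and intertwining operators -/

theorem dualAct_envι (X : lieAlg G) : dualAct π (envι _ X) = dualActX X := envLift_envι _ _ _

/-- The contragredient action is `ξ ↦ ξ ∘ dπ(ᵗu)`. -/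
theorem dualAct_apply (u : UC (lieAlg G)) (ξ : SmoothVec π →L[ℂ] ℂ) (v : SmoothVec π) :
    dualAct π u ξ v = ξ (dAct π (antipode _ u) v) := by
  induction u using env_induction generalizing v ξ with
  | hc a =>
    simp only [AlgHom.commutes, Module.algebraMap_end_apply, antipode_algebraMap,
      smul_apply, map_smul]
  | hι X =>
    rw [dualAct_envι, antipode_envι, dualActX_apply, map_neg, dAct_envι, LinearMap.neg_apply,
      map_neg]
  | hadd u w hu hw =>
    simp only [map_add, LinearMap.add_apply, add_apply, hu, hw]
  | hmul u w hu hw => simp only [antipode_mul, map_mul, Module.End.mul_apply, hu, hw]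

section Intertwining

variable {G' : LinGrp n} {hle : G' ≤ G} {H' : Type*} [NormedAddCommGroup H'] [NormedSpace ℂ H']
  {τ : BanachRep G' H'} {T : SmoothVec π →L[ℂ] SmoothVec τ}

theorem incl_expG (X : lieAlg G') : incl hle (expG X) = expG (lieIncl hle X) :=
  mat_injective (by rw [mat_expG]; exact mat_expG X)

/-- Symmetry breaking operators intertwine the actions of `𝔤'`. -/
theorem map_dActX (hT : T ∈ SymmetryBreaking hle π τ) (X : lieAlg G') (v : SmoothVec π) :
    T (dActX (lieIncl hle X) v) = dActX X (T v) := by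
  refine SmoothVec.val_injective ((SeparatingDual.eq_iff_forall_dual_eq (R := ℂ)).2 fun η => ?_)
  have h1 := hasDerivAt_form ((η.comp valL).comp T) v (lieIncl hle X)
  refine h1.unique ((hasDerivAt_form (η.comp valL) (T v) X).congr_of_eventuallyEq
    (Filter.Eventually.of_forall fun t => ?_))
  change η (T (smoothRep π (expG (t • lieIncl hle X)) v)).val = η (smoothRep τ (expG (t • X)) (T v)).val
  rw [← hT, incl_expG, map_smul]

theorem map_dAct (hT : T ∈ SymmetryBreaking hle π τ) (u : UC (lieAlg G')) (v : SmoothVec π) :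
    T (dAct π (envMap (lieIncl hle) u) v) = dAct τ u (T v) := by
  induction u using env_induction generalizing v with
  | hc a => simp only [AlgHom.commutes, Module.algebraMap_end_apply, map_smul]
  | hι X => rw [envMap_envι, dAct_envι, dAct_envι, map_dActX hT]
  | hadd u w hu hw => simp only [map_add, LinearMap.add_apply, hu, hw]
  | hmul u w hu hw => simp only [map_mul, Module.End.mul_apply, hu, hw]

theorem lDeriv_matCoeff (hT : T ∈ SymmetryBreaking hle π τ) (ξ : SmoothVec τ →L[ℂ] ℂ)
    (X : lieAlg G') (v : SmoothVec π) :
    lDeriv (lieIncl hle X) (matCoeff (ξ.comp T) v) = matCoeff ((dualActX X ξ).comp T) v := by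
  ext g
  refine (hasDerivAt_expG_neg_mul _ (matCoeff (ξ.comp T) v) g).unique ?_
  have h := hasDerivAt_form (ξ.comp T) (smoothRep π g v) (-lieIncl hle X)
  have e : ((matCoeff ((dualActX X ξ).comp T) v : SmoothFn G ℂ) : G → ℂ) g =
      (ξ.comp T) (dActX (-lieIncl hle X) (smoothRep π g v)) := by
    have e1 : dActX (-lieIncl hle X) (smoothRep π g v) =
        -dActX (lieIncl hle X) (smoothRep π g v) := by
      rw [← dAct_envι, map_neg, map_neg, dAct_envι]; rfl
    rw [e1, map_neg, matCoeff_apply]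
    change dualActX X ξ (T _) = -ξ (T _)
    rw [dualActX_apply, map_dActX hT]
  rw [e]
  refine h.congr_of_eventuallyEq (Filter.Eventually.of_forall fun t => ?_)
  change ξ (T (smoothRep π (expG ((-t) • lieIncl hle X) * g) v)) =
    ξ (T (smoothRep π (expG (t • (-lieIncl hle X))) (smoothRep π g v)))
  rw [map_mul, Module.End.mul_apply, neg_smul, smul_neg]

theorem lAct_matCoeff (hT : T ∈ SymmetryBreaking hle π τ) (ξ : SmoothVec τ →L[ℂ] ℂ)
    (u : UC (lieAlg G')) (v : SmoothVec π) :
    lAct (envMap (lieIncl hle) u) (matCoeff (ξ.comp T) v) =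
      matCoeff ((dualAct τ u ξ).comp T) v := by
  induction u using env_induction generalizing ξ with
  | hc a =>
    simp only [AlgHom.commutes, Module.algebraMap_end_apply, ContinuousLinearMap.smul_comp,
      matCoeff_smul_left]
  | hι X => rw [envMap_envι, lAct_ι, dualAct_envι, lDeriv_matCoeff hT]
  | hadd u w hu hw =>
    simp only [map_add, LinearMap.add_apply, ContinuousLinearMap.add_comp, hu, hw,
      matCoeff_add_left]
  | hmul u w hu hw => simp only [map_mul, Module.End.mul_apply, hu, hw]

end Intertwining

end Shintani

namespace Shintani

variable {n : ℕ} {G : LinGrp n} {H : Type*} [NormedAddCommGroup H] [NormedSpace ℂ H]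
  {π : BanachRep G H}

/-! ### Growth of Banach representations -/

theorem isCompact_matBounded (G : LinGrp n) (R : ℝ) :
    IsCompact {g : G | ‖mat g‖ ≤ R ∧ ‖mat g⁻¹‖ ≤ R} := by
  have h1 : Topology.IsClosedEmbedding fun g : G => Units.embedProduct (Mat n) (g : GL (Fin n) ℝ) :=
    Units.isClosedEmbedding_embedProduct.comp
      (Topology.IsClosedEmbedding.subtypeVal G.isClosed')
  have h2 : IsCompact (Metric.closedBall (0 : Mat n) R ×ˢ
      (MulOpposite.opHomeomorph '' Metric.closedBall (0 : Mat n) R)) :=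
    (isCompact_closedBall 0 R).prod ((isCompact_closedBall 0 R).image
      MulOpposite.opHomeomorph.continuous)
  convert h1.isCompact_preimage h2 using 1
  ext g
  constructor
  · rintro ⟨a, b⟩
    exact ⟨mem_closedBall_zero_iff.2 a, _, mem_closedBall_zero_iff.2 b, rfl⟩
  · rintro ⟨a, x, hx, hx'⟩
    refine ⟨mem_closedBall_zero_iff.1 a, ?_⟩
    have : x = mat g⁻¹ := MulOpposite.op_injective hx'
    rw [← this]
    exact mem_closedBall_zero_iff.1 hx

instance : LocallyCompactSpace G := by
  have h : Topology.IsClosedEmbedding (Subtype.val : G → GL (Fin n) ℝ) :=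
    Topology.IsClosedEmbedding.subtypeVal G.isClosed'
  exact h.locallyCompactSpace

/-- A Banach representation is bounded on compact sets. -/
theorem exists_norm_toHom_le [CompleteSpace H] (π : BanachRep G H) {Q : Set G}
    (hQ : IsCompact Q) : ∃ M, ∀ g ∈ Q, ‖π.toHom g‖ ≤ M := by
  obtain ⟨M, hM⟩ := banach_steinhaus (g := fun g : Q => π.toHom (g : G)) fun v => by
    have hc : Continuous fun g : G => π.toHom g v :=
      π.continuous_action.comp (continuous_id.prodMk continuous_const)
    obtain ⟨C, hC⟩ := hQ.exists_bound_of_continuousOn hc.continuousOn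
    exact ⟨C, fun g => hC g g.2⟩
  exact ⟨M, fun g hg => hM ⟨g, hg⟩⟩

/-- A symmetric matrix is bounded by the logarithm of the norms of its exponentials. -/
theorem exp_norm_le_of_isSymm [Nonempty (Fin n)] {X : Mat n} (hX : Xᵀ = X) :
    Real.exp ‖X‖ ≤ max ‖NormedSpace.exp X‖ ‖NormedSpace.exp (-X)‖ := by
  have hA : X.IsHermitian := by
    rw [Matrix.IsHermitian, Matrix.conjTranspose_eq_transpose_of_trivial, hX]
  set U := hA.eigenvectorUnitary with hU
  set v : Fin n → ℝ := hA.eigenvalues with hv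
  have hconj : ∀ D : Mat n, ‖(U : Mat n) * D * star (U : Mat n)‖ = ‖D‖ := fun D => by
    have : star (U : Mat n) = ((star U : unitary (Mat n)) : Mat n) := rfl
    rw [this, CStarRing.norm_mul_coe_unitary, CStarRing.norm_coe_unitary_mul]
  have hsp : X = (U : Mat n) * Matrix.diagonal v * star (U : Mat n) := hA.spectral_theorem
  have hexp : ∀ w : Fin n → ℝ, ‖NormedSpace.exp ((U : Mat n) * Matrix.diagonal w * star (U : Mat n))‖ =
      ‖(fun i => Real.exp (w i) : Fin n → ℝ)‖ := fun w => by
    have := Matrix.exp_units_conj (Unitary.toUnits U) (Matrix.diagonal w)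
    have e : ((Unitary.toUnits U)⁻¹ : (Mat n)ˣ).val = star (U : Mat n) := rfl
    have e' : ((Unitary.toUnits U) : (Mat n)ˣ).val = (U : Mat n) := rfl
    rw [e, e'] at this
    rw [this, hconj, Matrix.exp_diagonal, Matrix.l2_opNorm_diagonal]
    congr 1
    ext i
    rw [Pi.coe_exp, Real.exp_eq_exp_ℝ]
  obtain ⟨i, hi⟩ := Finite.exists_max fun i => |v i|
  have hXn : ‖X‖ ≤ |v i| := by
    rw [hsp, hconj, Matrix.l2_opNorm_diagonal]
    exact (pi_norm_le_iff_of_nonneg (abs_nonneg _)).2 hi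
  have hneg : -X = (U : Mat n) * Matrix.diagonal (-v) * star (U : Mat n) := by
    conv_lhs => rw [hsp]
    rw [show Matrix.diagonal (-v) = -Matrix.diagonal v from (Matrix.diagonal_neg v).symm]
    rw [mul_neg, neg_mul]
  have hle : ∀ w : Fin n → ℝ, Real.exp (w i) ≤ ‖(fun i => Real.exp (w i) : Fin n → ℝ)‖ := fun w =>
    (le_abs_self _).trans (norm_le_pi_norm (fun i => Real.exp (w i) : Fin n → ℝ) i)
  refine (Real.exp_le_exp.2 hXn).trans ?_
  rcases le_total 0 (v i) with h | h
  · rw [abs_of_nonneg h]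
    refine le_max_of_le_left ?_
    rw [hsp, hexp]
    exact hle v
  · rw [abs_of_nonpos h]
    refine le_max_of_le_right ?_
    rw [hneg, hexp]
    exact hle (-v)

theorem norm_mat_compactK_le {k : G} (hk : k ∈ compactK G) : ‖mat k‖ ≤ 1 := by
  have hk' : (mat k)ᵀ * mat k = 1 := hk
  have h := Matrix.l2_opNorm_conjTranspose_mul_self (mat k)
  rw [Matrix.conjTranspose_eq_transpose_of_trivial, hk'] at h
  have h1 := norm_one_mat_le (n := n)
  nlinarith [norm_nonneg (mat k)]

/-- In the Cartan decomposition `g = k exp X`, the norm of `X` grows at most logarithmically. -/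
theorem exp_norm_le_matSize [Nonempty (Fin n)] {k : G} (hk : k ∈ compactK G) {X : lieAlg G}
    (hX : (X : Mat n)ᵀ = X) : Real.exp ‖(X : Mat n)‖ ≤ matSize (k * expG X) := by
  refine (exp_norm_le_of_isSymm hX).trans (max_le ?_ ?_)
  · have e : NormedSpace.exp (X : Mat n) = mat k⁻¹ * mat (k * expG X) := by
      rw [← mat_mul, inv_mul_cancel_left, mat_expG]
    rw [e]
    refine (norm_mul_le _ _).trans ?_
    have := norm_mat_compactK_le ((compactK G).inv_mem hk)
    exact (mul_le_of_le_one_left (norm_nonneg _) this).trans (norm_mat_le_matSize _)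
  · have e : NormedSpace.exp (-(X : Mat n)) = mat (k * expG X)⁻¹ * mat k := by
      rw [← mat_mul, mul_inv_rev, inv_mul_cancel_right, ← expG_neg, mat_expG]; rfl
    rw [e]
    refine (norm_mul_le _ _).trans ?_
    have := norm_mat_compactK_le hk
    exact (mul_le_of_le_one_right (norm_nonneg _) this).trans (norm_mat_inv_le_matSize _)

theorem expG_nsmul (m : ℕ) (X : lieAlg G) : expG (m • X) = expG X ^ m := by
  apply mat_injective
  have hp : ∀ (g : G) (k : ℕ), mat (g ^ k) = mat g ^ k := fun g k => by
    induction k with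
    | zero => simp [mat_one]
    | succ k ih => rw [pow_succ, pow_succ, mat_mul, ih]
  rw [hp, mat_expG, mat_expG]
  let _ : NormedAlgebra ℚ (Mat n) := NormedAlgebra.restrictScalars ℚ ℝ (Mat n)
  exact NormedSpace.exp_nsmul m (X : Mat n)

/-- A Banach representation of a real reductive group has moderate growth: by the Cartan
decomposition, `g` is the product of an element of `K` and of `m` elements of a fixed compact set,
where `m` is of the order of `log ‖g‖`. -/
theorem exists_norm_toHom_le_matSize [Nonempty (Fin n)] [CompleteSpace H] (hG : IsRealReductive G)
    (π : BanachRep G H) : ∃ (C : ℝ) (d : ℕ), ∀ g, ‖π.toHom g‖ ≤ C * matSize g ^ d := by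
  -- `M` bounds `π` on `K` and on the elements `exp Y` with `‖Y‖ ≤ 1`; then `m` is chosen such that
  -- `X = m Y` with `‖Y‖ ≤ 1` and `m ≤ ‖X‖ + 1`.
  obtain ⟨R, hR⟩ : ∃ R, ∀ Y : Mat n, ‖Y‖ ≤ 1 → ‖NormedSpace.exp Y‖ ≤ R := by
    let _ : NormedAlgebra ℚ (Mat n) := NormedAlgebra.restrictScalars ℚ ℝ (Mat n)
    obtain ⟨R, hR⟩ := (isCompact_closedBall (0 : Mat n) 1).exists_bound_of_continuousOn
      (NormedSpace.exp_continuous (𝔸 := Mat n)).continuousOn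
    exact ⟨R, fun Y hY => hR Y (by simpa using hY)⟩
  obtain ⟨M, hM⟩ := exists_norm_toHom_le π (isCompact_matBounded G (max R 1))
  obtain ⟨d, hd⟩ := exists_nat_ge M
  have hd' : M ≤ Real.exp d := hd.trans ((by linarith : (d : ℝ) ≤ d + 1).trans (Real.add_one_le_exp _))
  refine ⟨Real.exp d * Real.exp d, d, fun g => ?_⟩
  obtain ⟨k, hk, X, hX, rfl⟩ := hG.cartan g
  have hkM : ‖π.toHom k‖ ≤ Real.exp d := (hM k
    ⟨(norm_mat_compactK_le hk).trans (le_max_right _ _),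
      (norm_mat_compactK_le ((compactK G).inv_mem hk)).trans (le_max_right _ _)⟩).trans hd'
  set m : ℕ := ⌊‖(X : Mat n)‖⌋₊ + 1 with hm
  have hm0 : (0 : ℝ) < m := by rw [hm]; positivity
  have hm1 : ‖(X : Mat n)‖ ≤ m := by
    rw [hm]; push_cast; exact (Nat.lt_floor_add_one _).le
  have hm2 : (m : ℝ) ≤ ‖(X : Mat n)‖ + 1 := by
    rw [hm]; push_cast; linarith [Nat.floor_le (norm_nonneg (X : Mat n))]
  set Y : lieAlg G := (m : ℝ)⁻¹ • X with hY
  have hY1 : ‖(Y : Mat n)‖ ≤ 1 := by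
    change ‖(m : ℝ)⁻¹ • (X : Mat n)‖ ≤ 1
    rw [norm_smul, norm_inv, Real.norm_natCast, inv_mul_le_iff₀ hm0, mul_one]
    exact hm1
  have hYX : expG X = expG Y ^ m := by
    rw [← expG_nsmul, hY, ← Nat.cast_smul_eq_nsmul ℝ, smul_smul, mul_inv_cancel₀ hm0.ne', one_smul]
  have hYM : ‖π.toHom (expG Y)‖ ≤ Real.exp d := by
    refine (hM _ ⟨?_, ?_⟩).trans hd'
    · rw [mat_expG]; exact (hR _ hY1).trans (le_max_left _ _)
    · rw [← expG_neg, mat_expG]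
      exact (hR _ (by rw [NegMemClass.coe_neg, norm_neg]; exact hY1)).trans (le_max_left _ _)
  have hpow : ‖π.toHom (expG Y ^ m)‖ ≤ Real.exp d ^ m := by
    rw [map_pow]
    refine (norm_pow_le' _ (by omega)).trans ?_
    gcongr
  calc ‖π.toHom (k * expG X)‖ ≤ ‖π.toHom k‖ * ‖π.toHom (expG Y ^ m)‖ := by
        rw [map_mul, hYX]; exact norm_mul_le _ _
    _ ≤ Real.exp d * Real.exp d ^ m := by gcongr
    _ ≤ Real.exp d * (Real.exp d * Real.exp ‖(X : Mat n)‖ ^ d) := by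
        gcongr
        rw [← Real.exp_nat_mul, ← Real.exp_nat_mul, ← Real.exp_add, Real.exp_le_exp]
        nlinarith [Nat.cast_nonneg (α := ℝ) d]
    _ ≤ Real.exp d * (Real.exp d * matSize (k * expG X) ^ d) := by
        gcongr
        exact exp_norm_le_matSize hk hX
    _ = _ := by ring

/-- A finite sum of families of functions of polynomial growth, where in each family the degree is
uniform. -/
theorem exists_growth_sum {V ι : Type*} [Fintype ι] {F : ι → V → G → ℂ}
    (h : ∀ j, ∃ d : ℕ, ∀ v, ∃ C : ℝ, ∀ g, ‖F j v g‖ ≤ C * matSize g ^ d) :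
    ∃ d : ℕ, ∀ v, ∃ C : ℝ, ∀ g, ‖∑ j, F j v g‖ ≤ C * matSize g ^ d := by
  choose d hd using h
  refine ⟨∑ j, d j, fun v => ?_⟩
  choose C hC using fun j => hd j v
  refine ⟨∑ j, |C j|, fun g => ?_⟩
  rw [Finset.sum_mul]
  refine (norm_sum_le _ _).trans (Finset.sum_le_sum fun j _ => (hC j g).trans ?_)
  have h1 := one_le_matSize g
  refine mul_le_mul (le_abs_self _) (pow_le_pow_right₀ h1 ?_)
    (pow_nonneg (zero_le_one.trans h1) _) (abs_nonneg _)
  exact Finset.single_le_sum (f := d) (fun _ _ => Nat.zero_le _) (Finset.mem_univ j)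

/-- The growth exponent of a matrix coefficient depends on the linear form only. -/
theorem exists_growth_matCoeff [Nonempty (Fin n)] [CompleteSpace H] (hG : IsRealReductive G)
    (l : SmoothVec π →L[ℂ] ℂ) :
    ∃ d : ℕ, ∀ v, ∃ C : ℝ, ∀ g, ‖l (smoothRep π g v)‖ ≤ C * matSize g ^ d := by
  obtain ⟨s, ξ, hl⟩ := exists_form_eq_sum l
  obtain ⟨C₀, d₀, h₀⟩ := exists_norm_toHom_le_matSize hG π
  simp only [hl]
  refine exists_growth_sum fun u => ?_
  obtain ⟨ι, _, c, w, h⟩ := exists_isAdExpansion (u : UC (lieAlg G))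
  have e : ∀ v g, ξ u (dAct π (u : UC (lieAlg G)) (smoothRep π g v)).val =
      ∑ j, (c j : G → ℂ) g * ξ u (π.toHom g (dAct π (w j) v).val) := fun v g => by
    rw [dAct_smoothRep, h.expand, val_smoothRep]
    simp [map_sum, LinearMap.sum_apply]
  simp only [e]
  refine exists_growth_sum fun j => ?_
  obtain ⟨C₁, d₁, h₁⟩ := h.growth j
  refine ⟨d₁ + d₀, fun v => ⟨C₁ * (‖ξ u‖ * (C₀ * ‖(dAct π (w j) v).val‖)), fun g => ?_⟩⟩
  rw [norm_mul]
  calc _ ≤ (C₁ * matSize g ^ d₁) * (‖ξ u‖ * ((C₀ * matSize g ^ d₀) * ‖(dAct π (w j) v).val‖)) := by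
        refine mul_le_mul (h₁ g) (((ξ u).le_opNorm _).trans ?_) (norm_nonneg _)
          ((norm_nonneg _).trans (h₁ g))
        gcongr
        exact (ContinuousLinearMap.le_opNorm _ _).trans (by gcongr; exact h₀ g)
    _ = _ := by ring

theorem norm_compression_le {E : Matrix (Fin n ⊕ Fin n) (Fin n) ℝ} (hE : Eᴴ * E = 1)
    (M : Matrix (Fin n ⊕ Fin n) (Fin n ⊕ Fin n) ℝ) : ‖Eᴴ * (M * E)‖ ≤ ‖M‖ := by
  have hEn : ‖E‖ ≤ 1 := by
    have h := Matrix.l2_opNorm_conjTranspose_mul_self E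
    rw [hE] at h
    nlinarith [norm_nonneg E, norm_one_mat_le (n := n)]
  calc ‖Eᴴ * (M * E)‖ ≤ ‖Eᴴ‖ * (‖M‖ * ‖E‖) := by
        refine (Matrix.l2_opNorm_mul _ _).trans ?_
        gcongr
        exact Matrix.l2_opNorm_mul _ _
    _ ≤ 1 * (‖M‖ * 1) := by
        rw [Matrix.l2_opNorm_conjTranspose]; gcongr
    _ = _ := by ring

theorem norm_le_norm_fromBlocks_left (A B : Mat n) : ‖A‖ ≤ ‖Matrix.fromBlocks A 0 0 B‖ := by
  have := norm_compression_le (E := Matrix.fromRows (1 : Mat n) 0)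
    (by simp [Matrix.transpose_fromRows, Matrix.fromCols_mul_fromRows])
    (Matrix.fromBlocks A 0 0 B)
  simpa [Matrix.fromBlocks_mul_fromRows, Matrix.transpose_fromRows,
    Matrix.fromCols_mul_fromRows] using this

theorem norm_le_norm_fromBlocks_right (A B : Mat n) : ‖B‖ ≤ ‖Matrix.fromBlocks A 0 0 B‖ := by
  have := norm_compression_le (E := Matrix.fromRows 0 (1 : Mat n))
    (by simp [Matrix.transpose_fromRows, Matrix.fromCols_mul_fromRows])
    (Matrix.fromBlocks A 0 0 B)
  simpa [Matrix.fromBlocks_mul_fromRows, Matrix.transpose_fromRows,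
    Matrix.fromCols_mul_fromRows] using this

theorem matSize_le_groupNorm [Nonempty (Fin n)] (g : G) : matSize g ≤ 3 * groupNorm g := by
  have h1 := one_le_groupNorm g
  have h2 : ‖mat g‖ ≤ groupNorm g := norm_le_norm_fromBlocks_left _ _
  have h3 : ‖mat g⁻¹‖ ≤ groupNorm g := by
    rw [← Matrix.l2_opNorm_conjTranspose, Matrix.conjTranspose_eq_transpose_of_trivial]
    exact norm_le_norm_fromBlocks_right _ _
  simp only [matSize]
  linarith

theorem hasGrowthBound_matCoeff [CompleteSpace H] (hG : IsRealReductive G)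
    (l : SmoothVec π →L[ℂ] ℂ) (v : SmoothVec π) : HasGrowthBound (matCoeff l v) := by
  rcases isEmpty_or_nonempty (Fin n) with hn | hn
  · have hs : ∀ x : G, x = 1 := fun x => mat_injective (Subsingleton.elim _ _)
    refine ⟨0, fun u => ⟨‖(rAct u (matCoeff l v) : G → ℂ) 1‖, fun x => ?_⟩⟩
    rw [hs x]; simp
  · obtain ⟨d, hd⟩ := exists_growth_matCoeff hG l
    refine ⟨d, fun u => ?_⟩
    obtain ⟨C, hC⟩ := hd (dAct π u v)
    refine ⟨|C| * 3 ^ d, fun x => ?_⟩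
    rw [rAct_matCoeff, matCoeff_apply, Real.rpow_natCast, mul_assoc, ← mul_pow]
    have h0 := zero_le_one.trans (one_le_matSize x)
    have h1 := matSize_le_groupNorm x
    refine (hC x).trans ?_
    gcongr
    exact le_abs_self C

end Shintani

namespace Shintani

open MeasureTheory

variable {n : ℕ} {G : LinGrp n} {H : Type*} [NormedAddCommGroup H] [NormedSpace ℂ H]
  {π : BanachRep G H}

/-! ### Integrals of smooth vectors -/

theorem continuous_toHom (π : BanachRep G H) (v : H) : Continuous fun g => π.toHom g v :=
  π.continuous_action.comp (continuous_id.prodMk continuous_const)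

theorem continuous_expG_smul (X : lieAlg G) : Continuous fun t : ℝ => expG (t • X) := by
  simp only [expG_smul]; exact continuous_oneParam _

theorem expG_add_smul (s t : ℝ) (X : lieAlg G) :
    expG ((s + t) • X) = expG (s • X) * expG (t • X) := by
  apply mat_injective
  rw [mat_mul, mat_expG, mat_expG, mat_expG]
  let _ : NormedAlgebra ℚ (Mat n) := NormedAlgebra.restrictScalars ℚ ℝ (Mat n)
  change NormedSpace.exp ((s + t) • (X : Mat n)) =
    NormedSpace.exp (s • (X : Mat n)) * NormedSpace.exp (t • (X : Mat n))
  rw [← NormedSpace.exp_add_of_commute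
    (((Commute.refl (X : Mat n)).smul_left s).smul_right t), ← add_smul]

theorem hasDerivAt_toHom_expG_at (X : lieAlg G) (v : SmoothVec π) (t : ℝ) :
    HasDerivAt (fun t : ℝ => π.toHom (expG (t • X)) v.val)
      (π.toHom (expG (t • X)) (dActX X v).val) t := by
  have h0 : HasDerivAt (fun s : ℝ => π.toHom (expG (s • X)) v.val) (dActX X v).val (t - t) := by
    rw [sub_self]; exact hasDerivAt_toHom_expG X v
  have h1 := ((π.toHom (expG (t • X))).restrictScalars ℝ).hasFDerivAt.comp_hasDerivAt t
    (h0.comp_sub_const t t)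
  refine h1.congr_of_eventuallyEq (Filter.Eventually.of_forall fun s => ?_)
  change π.toHom _ v.val = π.toHom _ (π.toHom _ v.val)
  rw [← mul_apply_eq_comp, ← map_mul, ← expG_add_smul, add_sub_cancel]

variable {α : Type*} [MeasurableSpace α] {μ : Measure α}

theorem val_dActX_integral [CompleteSpace H] {v : α → SmoothVec π} {Y : SmoothVec π}
    (X : lieAlg G) (hv : Integrable (fun a => (v a).val) μ)
    (hv' : Integrable (fun a => (dActX X (v a)).val) μ)
    (hY : Y.val = ∫ a, (v a).val ∂μ) : (dActX X Y).val = ∫ a, (dActX X (v a)).val ∂μ := by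
  obtain ⟨M, hM⟩ := exists_norm_toHom_le π
    ((isCompact_Icc (a := (-1 : ℝ)) (b := 1)).image (continuous_expG_smul X))
  have h := hasDerivAt_integral_of_dominated_loc_of_deriv_le (μ := μ) (x₀ := (0 : ℝ))
    (s := Set.Icc (-1 : ℝ) 1) (F := fun t a => π.toHom (expG (t • X)) (v a).val)
    (F' := fun t a => π.toHom (expG (t • X)) (dActX X (v a)).val)
    (bound := fun a => M * ‖(dActX X (v a)).val‖)
    (Icc_mem_nhds (by norm_num) (by norm_num))
    (Filter.Eventually.of_forall fun t => ((π.toHom _).integrable_comp hv).1)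
    ((π.toHom _).integrable_comp hv) ((π.toHom _).integrable_comp hv').1
    (Filter.Eventually.of_forall fun a t ht =>
      ((π.toHom _).le_opNorm _).trans (by gcongr; exact hM _ ⟨t, ht, rfl⟩))
    (hv'.norm.const_mul M)
    (Filter.Eventually.of_forall fun a t _ => hasDerivAt_toHom_expG_at X (v a) t)
  have h2 := h.2
  simp only [ContinuousLinearMap.integral_comp_comm _ hv, ← hY, zero_smul, expG_zero, map_one,
    one_apply_eq_self] at h2
  exact (hasDerivAt_toHom_expG X Y).unique h2

/-- The operators `dπ(u)` are closed, hence commute with integration. -/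
theorem val_dAct_integral [CompleteSpace H] {v : α → SmoothVec π} {Y : SmoothVec π}
    (hv : ∀ u, Integrable (fun a => (dAct π u (v a)).val) μ)
    (hY : Y.val = ∫ a, (v a).val ∂μ) (u : UC (lieAlg G)) :
    (dAct π u Y).val = ∫ a, (dAct π u (v a)).val ∂μ := by
  induction u using env_induction generalizing v Y with
  | hc a =>
    simp only [AlgHom.commutes, Module.algebraMap_end_apply, map_smul, integral_smul, hY]
  | hι X =>
    have h1 := hv 1
    have h2 := hv (envι _ X)
    simp only [map_one, Module.End.one_apply, dAct_envι] at h1 h2 ⊢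
    exact val_dActX_integral X h1 h2 hY
  | hadd u w hu hw =>
    simp only [map_add, LinearMap.add_apply]
    rw [integral_add (hv u) (hv w), hu hv hY, hw hv hY]
  | hmul u w hu hw =>
    simp only [map_mul, Module.End.mul_apply]
    refine hu (fun u' => ?_) (hw hv hY)
    have := hv (u' * w)
    simpa only [map_mul, Module.End.mul_apply] using this

theorem form_integral [CompleteSpace H] (l : SmoothVec π →L[ℂ] ℂ) {v : α → SmoothVec π}
    {Y : SmoothVec π} (hv : ∀ u, Integrable (fun a => (dAct π u (v a)).val) μ)
    (hY : Y.val = ∫ a, (v a).val ∂μ) : l Y = ∫ a, l (v a) ∂μ := by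
  obtain ⟨s, ξ, hl⟩ := exists_form_eq_sum l
  simp only [hl]
  rw [integral_finsetSum _ fun u _ => (ξ u).integrable_comp (hv u)]
  exact Finset.sum_congr rfl fun u _ => by
    rw [val_dAct_integral hv hY, ContinuousLinearMap.integral_comp_comm _ (hv u)]

/-! ### Polynomial functions on matrices -/

/-- Left translation of functions on matrices. -/
def leftTranslate (a : Mat n) : C(Mat n, ℝ) →ₐ[ℝ] C(Mat n, ℝ) :=
  ContinuousMap.compRightAlgHom ℝ ℝ ⟨fun x => a * x, continuous_const_mul a⟩

theorem leftTranslate_apply (a : Mat n) (f : C(Mat n, ℝ)) (x : Mat n) :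
    leftTranslate a f x = f (a * x) := rfl

/-- The algebra of the smooth functions on matrices whose left translates span a space of finite
dimension. It contains the polynomial functions. -/
def leftFinite (n : ℕ) : Subalgebra ℝ C(Mat n, ℝ) where
  carrier := {f | ContDiff ℝ ∞ f ∧
    ∃ V : Submodule ℝ C(Mat n, ℝ), V.FG ∧ ∀ a, leftTranslate a f ∈ V}
  add_mem' := by
    rintro f g ⟨hf, V, hV, hfV⟩ ⟨hg, W, hW, hgW⟩
    refine ⟨hf.add hg, V ⊔ W, hV.sup hW, fun a => ?_⟩
    rw [map_add]
    exact Submodule.add_mem_sup (hfV a) (hgW a)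
  mul_mem' := by
    rintro f g ⟨hf, V, hV, hfV⟩ ⟨hg, W, hW, hgW⟩
    refine ⟨hf.mul hg, V * W, hV.mul hW, fun a => ?_⟩
    rw [map_mul]
    exact Submodule.mul_mem_mul (hfV a) (hgW a)
  algebraMap_mem' c := by
    refine ⟨contDiff_const, Submodule.span ℝ {algebraMap ℝ _ c}, Submodule.fg_span_singleton _,
      fun a => ?_⟩
    rw [AlgHom.commutes]
    exact Submodule.mem_span_singleton_self _

/-- A matrix entry as a continuous function. -/
def entryFn (i j : Fin n) : C(Mat n, ℝ) := ⟨fun x => x i j, by fun_prop⟩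

theorem entryFn_mem_leftFinite (i j : Fin n) : entryFn i j ∈ leftFinite n := by
  refine ⟨?_, Submodule.span ℝ (Set.range fun l => entryFn l j),
    Submodule.fg_span (Set.finite_range _), fun a => ?_⟩
  · exact (LinearMap.toContinuousLinearMap (Matrix.entryLinearMap ℝ ℝ i j)).contDiff
  · have : leftTranslate a (entryFn i j) = ∑ l, a i l • entryFn l j := by
      ext x
      simp [leftTranslate_apply, entryFn, Matrix.mul_apply]
    rw [this]
    exact Submodule.sum_mem _ fun l _ =>
      Submodule.smul_mem _ _ (Submodule.subset_span ⟨l, rfl⟩)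

/-- By the Stone-Weierstrass theorem, continuous functions on a compact subset of `G` are
approximated by functions with finitely many left translates. -/
theorem exists_leftFinite_near {Q : Set G} (hQ : IsCompact Q) (φ : C(G, ℝ)) {ε : ℝ} (hε : 0 < ε) :
    ∃ P ∈ leftFinite n, ∀ g ∈ Q, |P (mat g) - φ g| < ε := by
  have : CompactSpace Q := isCompact_iff_compactSpace.1 hQ
  let r : C(Mat n, ℝ) →ₐ[ℝ] C(Q, ℝ) := ContinuousMap.compRightAlgHom ℝ ℝ
    ⟨fun q : Q => mat (q : G), continuous_mat.comp continuous_subtype_val⟩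
  have hsep : ((leftFinite n).map r).SeparatesPoints := by
    intro x y hxy
    have hm : mat (x : G) ≠ mat (y : G) := fun h => hxy (Subtype.ext (mat_injective h))
    obtain ⟨i, j, hij⟩ : ∃ i j, mat (x : G) i j ≠ mat (y : G) i j := by
      by_contra! h
      exact hm (Matrix.ext h)
    exact ⟨_, ⟨_, ⟨_, entryFn_mem_leftFinite i j, rfl⟩, rfl⟩, hij⟩
  obtain ⟨⟨_, P, hP, rfl⟩, hlt⟩ := ContinuousMap.exists_mem_subalgebra_near_continuous_of_separatesPoints
    _ hsep (fun q : Q => φ q) (φ.continuous.comp continuous_subtype_val) ε hε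
  exact ⟨P, hP, fun g hg => hlt ⟨g, hg⟩⟩

/-! ### A cutoff function invariant under the orthogonal group -/

/-- A bump function at the identity matrix. -/
noncomputable def matBump (n : ℕ) : ContDiffBump (1 : Mat n) := ⟨1 / 4, 1 / 2, by norm_num, by norm_num⟩

/-- A smooth function on matrices, invariant under left translation by orthogonal matrices, with
compact support in the group of invertible matrices. -/
noncomputable def cutoff (x : Mat n) : ℝ := matBump n (xᵀ * x)

theorem contDiff_cutoff : ContDiff ℝ ∞ (cutoff : Mat n → ℝ) := by
  have h1 : ContDiff ℝ ∞ fun x : Mat n => xᵀ :=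
    (LinearMap.toContinuousLinearMap
      (Matrix.transposeLinearEquiv (Fin n) (Fin n) ℝ ℝ).toLinearMap).contDiff
  exact (matBump n).contDiff.comp (h1.mul contDiff_id)

theorem cutoff_nonneg (x : Mat n) : 0 ≤ cutoff x := (matBump n).nonneg

theorem cutoff_one : cutoff (1 : Mat n) = 1 := by
  rw [cutoff, Matrix.transpose_one, mul_one]
  exact (matBump n).one_of_mem_closedBall (Metric.mem_closedBall_self (matBump n).rIn_pos.le)

theorem cutoff_mul {k : Mat n} (hk : kᵀ * k = 1) (x : Mat n) : cutoff (k * x) = cutoff x := by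
  rw [cutoff, cutoff, Matrix.transpose_mul, mul_assoc, ← mul_assoc kᵀ, hk, one_mul]

theorem norm_sub_one_lt_of_cutoff {x : Mat n} (hx : cutoff x ≠ 0) : ‖xᵀ * x - 1‖ < 1 / 2 := by
  by_contra! h
  refine hx ((matBump n).zero_of_le_dist ?_)
  rw [dist_eq_norm]
  exact h

theorem norm_sq_eq (x : Mat n) : ‖xᵀ * x‖ = ‖x‖ * ‖x‖ := by
  rw [← Matrix.conjTranspose_eq_transpose_of_trivial, Matrix.l2_opNorm_conjTranspose_mul_self]

theorem norm_le_two_of_cutoff {x : Mat n} (hx : cutoff x ≠ 0) : ‖x‖ ≤ 2 := by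
  have h1 := norm_sub_one_lt_of_cutoff hx
  have h2 : ‖x‖ * ‖x‖ ≤ ‖xᵀ * x - 1‖ + 1 := by
    rw [← norm_sq_eq]
    calc ‖xᵀ * x‖ = ‖(xᵀ * x - 1) + 1‖ := by rw [sub_add_cancel]
      _ ≤ _ := (norm_add_le _ _).trans (by gcongr; exact norm_one_mat_le)
  nlinarith [norm_nonneg x]

theorem norm_inv_le_two_of_cutoff {x y : Mat n} (hxy : x * y = 1) (hx : cutoff x ≠ 0) :
    ‖y‖ ≤ 2 := by
  have h1 := norm_sub_one_lt_of_cutoff hx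
  have e : yᵀ * y = 1 - yᵀ * (xᵀ * x - 1) * y := by
    have : yᵀ * (xᵀ * x) * y = 1 := by
      calc yᵀ * (xᵀ * x) * y = (x * y)ᵀ * (x * y) := by
            rw [Matrix.transpose_mul]; simp only [mul_assoc]
        _ = 1 := by rw [hxy, Matrix.transpose_one, mul_one]
    rw [mul_sub, sub_mul, this, mul_one, sub_sub_cancel]
  have ht : ‖yᵀ‖ = ‖y‖ := by
    rw [← Matrix.conjTranspose_eq_transpose_of_trivial, Matrix.l2_opNorm_conjTranspose]
  have h2 : ‖y‖ * ‖y‖ ≤ 1 + ‖y‖ * (1 / 2) * ‖y‖ := by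
    rw [← norm_sq_eq]
    conv_lhs => rw [e]
    refine (norm_sub_le _ _).trans (add_le_add norm_one_mat_le ?_)
    refine (norm_mul_le _ _).trans ?_
    gcongr
    refine (norm_mul_le _ _).trans ?_
    rw [ht]
    gcongr
  nlinarith [norm_nonneg y]

end Shintani

namespace Shintani

open MeasureTheory

variable {n : ℕ} {G : LinGrp n}

/-! ### Integrals against the cutoff function -/

section CutoffIntegrals

variable {E : Type*} [NormedAddCommGroup E] [NormedSpace ℂ E]

theorem cutoff_eq_zero_of_notMem {g : G} (hg : g ∉ {g : G | ‖mat g‖ ≤ 2 ∧ ‖mat g⁻¹‖ ≤ 2}) :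
    cutoff (mat g) = 0 := by
  by_contra h
  exact hg ⟨norm_le_two_of_cutoff h, norm_inv_le_two_of_cutoff (mat_mul_inv g) h⟩

theorem continuous_cutoff_mat : Continuous fun g : G => cutoff (mat g) :=
  contDiff_cutoff.continuous.comp continuous_mat

theorem hasCompactSupport_cutoff_mat : HasCompactSupport fun g : G => cutoff (mat g) :=
  HasCompactSupport.intro (isCompact_matBounded G 2) fun _ hg => cutoff_eq_zero_of_notMem hg

variable [MeasurableSpace G] [BorelSpace G] (μ : Measure G) [μ.IsHaarMeasure]

theorem integrable_cutoff (P : C(Mat n, ℝ)) {y : G → E} (hy : Continuous y) :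
    Integrable (fun g : G => (P (mat g) * cutoff (mat g)) • y g) μ :=
  (((P.continuous.comp continuous_mat).mul continuous_cutoff_mat).smul
    hy).integrable_of_hasCompactSupport
    ((hasCompactSupport_cutoff_mat.mul_left (f := fun g => P (mat g))).smul_right)

/-- The integral of a continuous function on `G` against `P` times the cutoff function, as a linear
function of `P`. -/
noncomputable def cutInt (y : C(G, E)) : C(Mat n, ℝ) →ₗ[ℝ] E where
  toFun P := ∫ g, (P (mat g) * cutoff (mat g)) • y g ∂μ
  map_add' P P' := by
    rw [← integral_add (integrable_cutoff μ P y.continuous) (integrable_cutoff μ P' y.continuous)]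
    simp only [ContinuousMap.add_apply, add_mul, add_smul]
  map_smul' c P := by
    rw [RingHom.id_apply, ← integral_smul]
    simp only [ContinuousMap.smul_apply, smul_eq_mul, mul_assoc, mul_smul]

theorem cutInt_apply (y : C(G, E)) (P : C(Mat n, ℝ)) :
    cutInt μ y P = ∫ g, (P (mat g) * cutoff (mat g)) • y g ∂μ := rfl

theorem cutInt_translate {k : G} (hk : k ∈ compactK G) (y : C(G, E)) (P : C(Mat n, ℝ)) :
    ∫ g, (P (mat g) * cutoff (mat g)) • y (k * g) ∂μ =
      cutInt μ y (leftTranslate (mat k⁻¹) P) := by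
  rw [cutInt_apply, ← integral_mul_left_eq_self
    (fun g => (leftTranslate (mat k⁻¹) P (mat g) * cutoff (mat g)) • y g) k]
  refine integral_congr_ae (Filter.Eventually.of_forall fun g => ?_)
  have hc : cutoff (mat (k * g)) = cutoff (mat g) := by rw [mat_mul]; exact cutoff_mul hk _
  simp only [leftTranslate_apply, hc]
  rw [← mat_mul, inv_mul_cancel_left]

/-- A continuous function orthogonal to all products of the cutoff function and a left finite
function vanishes at the identity. -/
theorem eq_zero_of_cutInt_eq_zero (y : C(G, ℂ)) (h : ∀ P ∈ leftFinite n, cutInt μ y P = 0) :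
    y 1 = 0 := by
  have hint : ∀ φ : C(G, ℝ), Integrable (fun g : G => (φ g * cutoff (mat g)) • y g) μ := fun φ =>
    ((φ.continuous.mul continuous_cutoff_mat).smul y.continuous).integrable_of_hasCompactSupport
      ((hasCompactSupport_cutoff_mat.mul_left (f := φ)).smul_right)
  have hint' : Integrable (fun g : G => cutoff (mat g) * ‖y g‖) μ :=
    (continuous_cutoff_mat.mul y.continuous.norm).integrable_of_hasCompactSupport
      hasCompactSupport_cutoff_mat.mul_right
  have key : ∀ φ : C(G, ℝ), ∫ g, (φ g * cutoff (mat g)) • y g ∂μ = 0 := by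
    intro φ
    set D := ∫ g, cutoff (mat g) * ‖y g‖ ∂μ with hD
    have hD0 : 0 ≤ D := integral_nonneg fun g => mul_nonneg (cutoff_nonneg _) (norm_nonneg _)
    have hle : ∀ ε > 0, ‖∫ g, (φ g * cutoff (mat g)) • y g ∂μ‖ ≤ ε * D := by
      intro ε hε
      obtain ⟨P, hP, hPφ⟩ := exists_leftFinite_near (isCompact_matBounded G 2) φ hε
      have e : ∫ g, (φ g * cutoff (mat g)) • y g ∂μ =
          ∫ g, ((φ g - P (mat g)) * cutoff (mat g)) • y g ∂μ := by
        have h1 := h P hP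
        rw [cutInt_apply] at h1
        rw [← sub_zero (∫ g, (φ g * cutoff (mat g)) • y g ∂μ), ← h1,
          ← integral_sub (hint φ) (integrable_cutoff μ P y.continuous)]
        simp only [sub_mul, sub_smul]
      rw [e, hD, ← integral_const_mul]
      refine norm_integral_le_of_norm_le (hint'.const_mul ε)
        (Filter.Eventually.of_forall fun g => ?_)
      by_cases hg : g ∈ {g : G | ‖mat g‖ ≤ 2 ∧ ‖mat g⁻¹‖ ≤ 2}
      · rw [norm_smul, norm_mul, Real.norm_eq_abs, Real.norm_of_nonneg (cutoff_nonneg _), mul_assoc,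
          abs_sub_comm]
        exact mul_le_mul_of_nonneg_right (hPφ g hg).le
          (mul_nonneg (cutoff_nonneg _) (norm_nonneg _))
      · simp [cutoff_eq_zero_of_notMem hg]
    rw [← norm_le_zero_iff]
    refine le_of_forall_pos_le_add fun δ hδ => ?_
    rw [zero_add]
    refine (hle (δ / (D + 1)) (by positivity)).trans ?_
    rw [div_mul_eq_mul_div, div_le_iff₀ (by positivity)]
    nlinarith
  -- Taking `φ` to be the real or imaginary part of `y` gives `∫ cutoff * φ ^ 2 = 0`.
  have hL : ∀ L : ℂ →L[ℝ] ℝ, L (y 1) = 0 := by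
    intro L
    let φ : C(G, ℝ) := ⟨fun g => L (y g), L.continuous.comp y.continuous⟩
    have h1 : ∫ g, (φ g * cutoff (mat g)) * φ g ∂μ = 0 := by
      have := L.integral_comp_comm (hint φ)
      rw [key φ, map_zero] at this
      rw [← this]
      refine integral_congr_ae (Filter.Eventually.of_forall fun g => ?_)
      simp only [map_smul, smul_eq_mul]
      rfl
    have hcont : Continuous fun g : G => φ g * cutoff (mat g) * φ g :=
      (φ.continuous.mul continuous_cutoff_mat).mul φ.continuous
    by_contra hne
    refine (hcont.integral_pos_of_hasCompactSupport_nonneg_nonzero (μ := μ)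
      (hasCompactSupport_cutoff_mat.mul_left.mul_right) (fun g => ?_) (x := 1) ?_).ne' h1
    · change 0 ≤ φ g * cutoff (mat g) * φ g
      nlinarith [mul_nonneg (cutoff_nonneg (mat g)) (mul_self_nonneg (φ g))]
    · rw [mat_one, cutoff_one, mul_one]
      exact mul_self_ne_zero.2 hne
  exact Complex.ext (hL Complex.reCLM) (hL Complex.imCLM)

/-- Convolution with a smooth function of compact support in the group produces smooth functions.
The extension to matrices near `h₀` is `x ↦ ∫ f(x⁻¹ g) y(g) dg`, which is written as a convolution on
the space of matrices with respect to the image of the measure `μ`, restricted to a compact set. -/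
theorem isSmooth_convolution {f : Mat n → ℝ} (hf : ContDiff ℝ ∞ f) {R : ℝ}
    (hR : ∀ x, f x ≠ 0 → ‖x‖ ≤ R) (hR' : ∀ x y, x * y = 1 → f x ≠ 0 → ‖y‖ ≤ R) {y : G → E}
    (hy : Continuous y) : IsSmooth fun h : G => ∫ g, f (mat (h⁻¹ * g)) • y g ∂μ := by
  intro h₀
  let _ : MeasurableSpace (Mat n) := borel _
  have _ : BorelSpace (Mat n) := ⟨rfl⟩
  have hemb : MeasurableEmbedding (mat : G → Mat n) := by
    let _ : MeasurableSpace (GL (Fin n) ℝ) := borel _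
    have _ : BorelSpace (GL (Fin n) ℝ) := ⟨rfl⟩
    have h : Topology.IsClosedEmbedding (Subtype.val : G → GL (Fin n) ℝ) :=
      Topology.IsClosedEmbedding.subtypeVal G.isClosed'
    exact (Units.isOpenEmbedding_val (R := Mat n)).measurableEmbedding.comp h.measurableEmbedding
  set r := matSize h₀ + 1 with hr
  have hr0 : 0 ≤ r := by linarith [one_le_matSize h₀]
  set U : Set (Mat n) := {x | IsUnit x ∧ ‖x‖ < r} with hU
  have hUo : IsOpen U := Units.isOpen.inter (isOpen_lt continuous_norm continuous_const)
  have hinv : ContDiffOn ℝ ∞ (Ring.inverse : Mat n → Mat n) U := fun x hx => by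
    obtain ⟨u, rfl⟩ := hx.1
    exact (contDiffAt_ringInverse ℝ u).contDiffWithinAt
  have hmi : ∀ h : G, Ring.inverse (mat h) = mat h⁻¹ := fun h =>
    Ring.inverse_unit (h : GL (Fin n) ℝ)
  set Q : Set G := {g : G | ‖mat g‖ ≤ r * R ∧ ‖mat g⁻¹‖ ≤ r * R} with hQ
  have hQc : IsCompact Q := isCompact_matBounded G _
  set ν : Measure (Mat n) := (μ.restrict Q).map mat with hν
  set Y : Mat n → E := Function.extend mat y 0 with hY
  have hYm : ∀ g : G, Y (mat g) = y g := fun g => mat_injective.extend_apply _ _ _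
  have hYi : Integrable Y ν := by
    rw [hν, hemb.integrable_map_iff]
    have : Y ∘ mat = y := funext hYm
    rw [this]
    exact hy.continuousOn.integrableOn_compact hQc
  set L : E →L[ℝ] ℝ →L[ℝ] E := (ContinuousLinearMap.lsmul ℝ ℝ).flip with hL
  have hconv := contDiffOn_convolution_right_with_param_comp (𝕜 := ℝ) (μ := ν) (n := ⊤) L
    (v := fun _ : Mat n => (0 : Mat n)) (f := Y) (s := U) contDiffOn_const
    (g := fun x s => f (Ring.inverse x * (-s))) (k := Metric.closedBall 0 (r * R)) hUo
    (isCompact_closedBall _ _) (fun x s hx hs => by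
      by_contra hne
      apply hs
      rw [mem_closedBall_zero_iff]
      have e : s = -(x * (Ring.inverse x * (-s))) := by
        rw [← mul_assoc, Ring.mul_inverse_cancel x hx.1]; simp
      rw [e, norm_neg]
      exact (norm_mul_le _ _).trans (mul_le_mul hx.2.le (hR _ hne) (norm_nonneg _) hr0))
    hYi.locallyIntegrable (by
      have h1 : ContDiffOn ℝ ∞ (fun p : Mat n × Mat n => Ring.inverse p.1 * (-p.2))
          (U ×ˢ Set.univ) :=
        (hinv.comp contDiff_fst.contDiffOn fun p hp => hp.1).mul contDiff_snd.neg.contDiffOn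
      exact hf.comp_contDiffOn h1)
  refine ⟨_, (hconv.contDiffAt (hUo.mem_nhds ?_)), ?_⟩
  · exact ⟨(h₀ : GL (Fin n) ℝ).isUnit, by linarith [norm_mat_le_matSize h₀]⟩
  · have hnear : ∀ᶠ h : G in 𝓝 h₀, ‖mat h‖ < r ∧ ‖mat h⁻¹‖ < r := by
      refine Filter.Eventually.and ?_ ?_
      · exact continuous_mat.norm.continuousAt.eventually_lt_const
          (by linarith [norm_mat_le_matSize h₀])
      · exact (continuous_mat.comp continuous_inv).norm.continuousAt.eventually_lt_const
          (by
            change ‖mat h₀⁻¹‖ < r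
            linarith [norm_mat_inv_le_matSize h₀])
    filter_upwards [hnear] with h hh
    rw [convolution_def, hν, hemb.integral_map]
    simp only [hYm, zero_sub, neg_neg, hmi, ← mat_mul]
    refine (setIntegral_eq_integral_of_forall_compl_eq_zero fun g hg => ?_).symm
    by_contra hne
    have hne' : f (mat (h⁻¹ * g)) ≠ 0 := fun h0 => hne (by rw [h0, zero_smul])
    apply hg
    constructor
    · have e : mat g = mat h * mat (h⁻¹ * g) := by rw [← mat_mul, mul_inv_cancel_left]
      rw [e]
      exact (norm_mul_le _ _).trans
        (mul_le_mul hh.1.le (hR _ hne') (norm_nonneg _) hr0)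
    · have e : mat g⁻¹ = mat (h⁻¹ * g)⁻¹ * mat h⁻¹ := by
        rw [← mat_mul, mul_inv_rev, inv_inv, mul_assoc, mul_inv_cancel, mul_one]
      rw [e, mul_comm r]
      exact (norm_mul_le _ _).trans (mul_le_mul (hR' _ _ (mat_mul_inv _) hne') hh.2.le
        (norm_nonneg _) ((norm_nonneg _).trans (hR _ hne')))

end CutoffIntegrals

end Shintani

namespace Shintani

open MeasureTheory

variable {n : ℕ} {G : LinGrp n} {H : Type*} [NormedAddCommGroup H] [NormedSpace ℂ H]
  {π : BanachRep G H}

/-! ### Density of `K`-finite vectors -/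

/-- A real linear image of a finitely generated space spans a complex space of finite dimension. -/
theorem finiteDimensional_span_image {M W : Type*} [AddCommGroup M] [Module ℝ M] [AddCommGroup W]
    [Module ℂ W] (J : M →ₗ[ℝ] W) {V : Submodule ℝ M} (hV : V.FG) {ι : Type*} {f : ι → W}
    (hf : ∀ i, ∃ P ∈ V, J P = f i) : FiniteDimensional ℂ (Submodule.span ℂ (Set.range f)) := by
  obtain ⟨S, rfl⟩ := hV
  have : FiniteDimensional ℂ (Submodule.span ℂ (J '' (S : Set M))) :=
    FiniteDimensional.span_of_finite ℂ (S.finite_toSet.image J)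
  refine Submodule.finiteDimensional_of_le (S₂ := Submodule.span ℂ (J '' (S : Set M)))
    (Submodule.span_le.2 ?_)
  rintro _ ⟨i, rfl⟩
  obtain ⟨P, hP, hPi⟩ := hf i
  rw [← hPi]
  have hle : Submodule.span ℝ (S : Set M) ≤
      ((Submodule.span ℂ (J '' (S : Set M))).restrictScalars ℝ).comap J :=
    Submodule.span_le.2 fun x hx => Submodule.subset_span (Set.mem_image_of_mem J hx)
  exact hle hP

section Garding

variable [MeasurableSpace G] [BorelSpace G] (μ : Measure G) [μ.IsHaarMeasure]

/-- The orbit map of a vector as a continuous function. -/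
noncomputable def orbitC (π : BanachRep G H) (v : H) : C(G, H) := ⟨fun g => π.toHom g v, continuous_toHom π v⟩

theorem cutInt_orbitC_mem [CompleteSpace H] {P : C(Mat n, ℝ)} (hP : P ∈ leftFinite n) (v : H) :
    cutInt μ (orbitC π v) P ∈ smoothVectors π := by
  have hs := isSmooth_convolution μ (f := fun x => P x * cutoff x) (hP.1.mul contDiff_cutoff)
    (R := 2) (fun x hx => norm_le_two_of_cutoff (right_ne_zero_of_mul hx))
    (fun x y hxy hx => norm_inv_le_two_of_cutoff hxy (right_ne_zero_of_mul hx))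
    (continuous_toHom π v)
  change IsSmooth _
  convert hs using 2 with h
  rw [cutInt_apply, ← ContinuousLinearMap.integral_comp_comm _
    (integrable_cutoff μ P (orbitC π v).continuous),
    ← integral_mul_left_eq_self
      (fun g => (P (mat (h⁻¹ * g)) * cutoff (mat (h⁻¹ * g))) • π.toHom g v) h]
  refine integral_congr_ae (Filter.Eventually.of_forall fun g => ?_)
  have e : ∀ (r : ℝ) (x : H), π.toHom h (r • x) = r • π.toHom h x := fun r x =>
    ((π.toHom h).restrictScalars ℝ).map_smul r x
  simp only [inv_mul_cancel_left, e]
  rw [map_mul]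
  rfl

/-- The Gårding vector `∫ P(g) cutoff(g) π(g) v dg`. -/
noncomputable def gardingVec [CompleteSpace H] (P : leftFinite n) (v : SmoothVec π) :
    SmoothVec π :=
  ⟨cutInt μ (orbitC π v.val) P, cutInt_orbitC_mem μ P.2 v.val⟩

theorem val_gardingVec [CompleteSpace H] (P : leftFinite n) (v : SmoothVec π) :
    (gardingVec μ P v).val = cutInt μ (orbitC π v.val) P := rfl

/-- Since the cutoff function is invariant under `K`, the `K`-translates of a Gårding vector come
from left translates of `P`. -/
theorem isKFinite_gardingVec [CompleteSpace H] (P : leftFinite n) (v : SmoothVec π) :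
    IsKFinite (gardingVec μ P v) := by
  obtain ⟨-, V, hV, hPV⟩ := P.2
  have hval : ∀ k : compactK G, (smoothRep π (k : G) (gardingVec μ P v)).val =
      cutInt μ (orbitC π v.val) (leftTranslate (mat (k : G)⁻¹) P) := fun k => by
    rw [val_smoothRep, val_gardingVec, ← cutInt_translate μ k.2, cutInt_apply,
      ← ContinuousLinearMap.integral_comp_comm _
        (integrable_cutoff μ _ (orbitC π v.val).continuous)]
    refine integral_congr_ae (Filter.Eventually.of_forall fun g => ?_)
    have e : ∀ (r : ℝ) (x : H), π.toHom k (r • x) = r • π.toHom k x := fun r x =>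
      ((π.toHom k).restrictScalars ℝ).map_smul r x
    simp only [e]
    change _ = _ • π.toHom (k * g) v.val
    rw [map_mul]
    rfl
  have hfd : FiniteDimensional ℂ (Submodule.span ℂ
      (Set.range fun k : compactK G => (smoothRep π (k : G) (gardingVec μ P v)).val)) :=
    finiteDimensional_span_image (cutInt μ (orbitC π v.val)) hV
      fun k => ⟨_, hPV _, (hval k).symm⟩
  have hmap : (Submodule.span ℂ (Set.range fun k : compactK G =>
      smoothRep π (k : G) (gardingVec μ P v))).map SmoothVec.val =
      Submodule.span ℂ (Set.range fun k : compactK G =>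
        (smoothRep π (k : G) (gardingVec μ P v)).val) := by
    rw [Submodule.map_span, ← Set.range_comp]; rfl
  rw [← hmap] at hfd
  exact (Submodule.equivMapOfInjective SmoothVec.val SmoothVec.val_injective
    _).symm.finiteDimensional

theorem form_gardingVec [CompleteSpace H] (l : SmoothVec π →L[ℂ] ℂ) (P : leftFinite n)
    (v : SmoothVec π) : l (gardingVec μ P v) =
      cutInt μ ⟨fun g => l (smoothRep π g v), continuous_smoothFn (matCoeff l v)⟩ P := by
  have hl := form_integral (μ := μ) l (Y := gardingVec μ P v)
    (v := fun g => (((P : C(Mat n, ℝ)) (mat g) * cutoff (mat g) : ℝ) : ℂ) • smoothRep π g v)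
    (fun u => ?_) ?_
  · rw [hl, cutInt_apply]
    simp only [map_smul]
    rfl
  · obtain ⟨f, hf, -⟩ := exists_smooth_dAct u v
    simp only [map_smul, ← hf]
    exact integrable_cutoff μ P (continuous_smoothFn f)
  · rw [val_gardingVec, cutInt_apply]
    simp only [map_smul]
    rfl

end Garding

/-- The `K`-finite vectors are dense in `H^∞`, in dual form: a continuous linear form that vanishes
on them is zero. The Gårding vectors suffice. -/
theorem form_eq_zero_of_isKFinite [CompleteSpace H] {l : SmoothVec π →L[ℂ] ℂ}
    (hl : ∀ w, IsKFinite w → l w = 0) : l = 0 := by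
  ext v
  let _ : MeasurableSpace G := borel G
  have _ : BorelSpace G := ⟨rfl⟩
  have := eq_zero_of_cutInt_eq_zero (Measure.haar : Measure G)
    ⟨fun g => l (smoothRep π g v), continuous_smoothFn (matCoeff l v)⟩ fun P hP => by
      rw [← form_gardingVec (Measure.haar : Measure G) l ⟨P, hP⟩ v]
      exact hl _ (isKFinite_gardingVec _ _ _)
  change l (smoothRep π 1 v) = 0 at this
  simpa using this

/-! ### Separation of points by `K`-finite linear forms -/

section Forms

variable [MeasurableSpace G] [BorelSpace G] (μ : Measure G) [μ.IsHaarMeasure]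

/-- The continuous function `g ↦ ξ(π(g⁻¹) v)`. -/
noncomputable def coOrbitC (π : BanachRep G H) (ξ : H →L[ℂ] ℂ) (v : H) : C(G, ℂ) :=
  ⟨fun g => ξ (π.toHom g⁻¹ v), ξ.continuous.comp ((continuous_toHom π v).comp continuous_inv)⟩

theorem exists_norm_cutInt_coOrbitC_le [CompleteSpace H] (π : BanachRep G H) (ξ : H →L[ℂ] ℂ)
    (P : C(Mat n, ℝ)) : ∃ C, ∀ v, ‖cutInt μ (coOrbitC π ξ v) P‖ ≤ C * ‖v‖ := by
  obtain ⟨M, hM⟩ := exists_norm_toHom_le π (isCompact_matBounded G 2)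
  have hi := (integrable_cutoff μ P (continuous_const (y := (1 : ℂ)))).norm
  refine ⟨(∫ g, ‖(P (mat g) * cutoff (mat g)) • (1 : ℂ)‖ ∂μ) * (‖ξ‖ * M), fun v => ?_⟩
  rw [mul_assoc, ← integral_mul_const]
  refine norm_integral_le_of_norm_le (hi.mul_const _) (Filter.Eventually.of_forall fun g => ?_)
  by_cases hg : g ∈ {g : G | ‖mat g‖ ≤ 2 ∧ ‖mat g⁻¹‖ ≤ 2}
  · rw [norm_smul, norm_smul, norm_one, mul_one, mul_assoc ‖ξ‖]
    gcongr
    refine (ξ.le_opNorm _).trans ?_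
    gcongr
    refine ((π.toHom g⁻¹).le_opNorm v).trans ?_
    gcongr
    exact hM _ ⟨hg.2, by rw [inv_inv]; exact hg.1⟩
  · simp [cutoff_eq_zero_of_notMem hg]

/-- The linear form `v ↦ ∫ P(g) cutoff(g) ξ(π(g⁻¹) v) dg`. -/
noncomputable def gardingForm [CompleteSpace H] (π : BanachRep G H) (ξ : H →L[ℂ] ℂ)
    (P : C(Mat n, ℝ)) : H →L[ℂ] ℂ :=
  LinearMap.mkContinuousOfExistsBound
    { toFun := fun v => cutInt μ (coOrbitC π ξ v) P
      map_add' := fun v w => by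
        simp only [cutInt_apply]
        rw [← integral_add (integrable_cutoff μ P (coOrbitC π ξ v).continuous)
          (integrable_cutoff μ P (coOrbitC π ξ w).continuous)]
        simp [coOrbitC]
      map_smul' := fun a v => by
        simp only [cutInt_apply]
        rw [RingHom.id_apply, ← integral_smul]
        refine integral_congr_ae (Filter.Eventually.of_forall fun g => ?_)
        simp [coOrbitC]
        ring }
    (exists_norm_cutInt_coOrbitC_le μ π ξ P)

/-- As for Gårding vectors, the `K`-translates come from left translates of `P`. -/
theorem isKFiniteForm_gardingForm [CompleteSpace H] (ξ : H →L[ℂ] ℂ) {P : C(Mat n, ℝ)}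
    (hP : P ∈ leftFinite n) :
    IsKFiniteForm ((gardingForm μ π ξ P).comp (valL : SmoothVec π →L[ℂ] H)) := by
  obtain ⟨-, V, hV, hPV⟩ := hP
  let J : C(Mat n, ℝ) →ₗ[ℝ] (SmoothVec π →ₗ[ℂ] ℂ) :=
    { toFun := fun P => (((gardingForm μ π ξ P).comp (valL : SmoothVec π →L[ℂ] H) :
        SmoothVec π →L[ℂ] ℂ) : SmoothVec π →ₗ[ℂ] ℂ)
      map_add' := fun P P' => LinearMap.ext fun v =>
        map_add (cutInt μ (coOrbitC π ξ v.val)) P P'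
      map_smul' := fun c P => LinearMap.ext fun v =>
        map_smul (cutInt μ (coOrbitC π ξ v.val)) c P }
  refine finiteDimensional_span_image J hV fun k => ⟨_, hPV (mat (k : G)⁻¹), ?_⟩
  refine LinearMap.ext fun v => ?_
  change cutInt μ (coOrbitC π ξ v.val) _ = cutInt μ (coOrbitC π ξ (π.toHom (k : G)⁻¹ v.val)) P
  rw [← cutInt_translate μ k.2, cutInt_apply]
  refine integral_congr_ae (Filter.Eventually.of_forall fun g => ?_)
  change _ • ξ (π.toHom (k * g)⁻¹ v.val) = _ • ξ (π.toHom g⁻¹ (π.toHom (k : G)⁻¹ v.val))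
  rw [mul_inv_rev, map_mul, mul_apply_eq_comp]

end Forms

/-- The `K`-finite continuous linear forms separate the points of `H^∞`. -/
theorem eq_zero_of_isKFiniteForm [CompleteSpace H] {v : SmoothVec π}
    (hv : ∀ η : SmoothVec π →L[ℂ] ℂ, IsKFiniteForm η → η v = 0) : v = 0 := by
  let _ : MeasurableSpace G := borel G
  have _ : BorelSpace G := ⟨rfl⟩
  refine SmoothVec.val_injective ((SeparatingDual.eq_iff_forall_dual_eq (R := ℂ)).2 fun ξ => ?_)
  have := eq_zero_of_cutInt_eq_zero (Measure.haar : Measure G) (coOrbitC π ξ v.val)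
    fun P hP => hv _ (isKFiniteForm_gardingForm Measure.haar ξ hP)
  simpa [coOrbitC] using this

/-! ### Shintani functions from symmetry breaking operators -/

section ShintaniFunctions

variable {G' : LinGrp n} {hle : G' ≤ G} {H' : Type*} [NormedAddCommGroup H'] [NormedSpace ℂ H']
  {τ : BanachRep G' H'}

/-- The left differential equation holds since `L_u` acts through the contragredient of `τ`, on
which `u` acts by `χ_{-ν}(ᵗu) = χ_ν(u)`. -/
theorem matCoeff_mem_sh {𝔧 : LieSubalgebra ℝ (lieAlg G)} {𝔧' : LieSubalgebra ℝ (lieAlg G')}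
    {lam : Module.Dual ℂ (Cplx 𝔧)} {ν : Module.Dual ℂ (Cplx 𝔧')}
    (hπχ : HasInfinitesimalCharacter π (chi 𝔧 lam))
    (hτχ : HasInfinitesimalCharacter τ (chi 𝔧' (-ν)))
    {v : SmoothVec π} (hv : IsSpherical v) {ξ : SmoothVec τ →L[ℂ] ℂ} (hξ : IsSphericalForm ξ)
    {T : SmoothVec π →L[ℂ] SmoothVec τ} (hT : T ∈ SymmetryBreaking hle π τ) :
    matCoeff (ξ.comp T) v ∈ Sh hle lam ν := by
  refine ⟨fun k' hk' k hk g => ?_, fun u => ?_, fun u => ?_⟩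
  · change ξ (T (smoothRep π (incl hle k' * g * k) v)) = ξ (T (smoothRep π g v))
    rw [map_mul, map_mul, Module.End.mul_apply, Module.End.mul_apply, hv k hk, hT]
    have := hξ k'⁻¹ ((compactK G').inv_mem hk') (T (smoothRep π g v))
    rwa [inv_inv] at this
  · rw [rAct_matCoeff, hπχ, matCoeff_smul]
  · rw [lAct_matCoeff hT, ← chi_neg_antipode, ← matCoeff_smul_left]
    congr 1
    ext w
    change dualAct τ (u : UC (lieAlg G')) ξ (T w) =
      chi 𝔧' (-ν) ⟨antipode _ (u : UC (lieAlg G')), antipode_mem_ZG u.2⟩ • ξ (T w)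
    rw [dualAct_apply, hτχ ⟨_, antipode_mem_ZG u.2⟩, map_smul]

theorem matCoeff_mem_moderateGrowth [CompleteSpace H] (hG : IsRealReductive G)
    {χ : ZG G → ℂ} (hπχ : HasInfinitesimalCharacter π χ) {v : SmoothVec π} (hv : IsSpherical v)
    (l : SmoothVec π →L[ℂ] ℂ) : matCoeff l v ∈ ModerateGrowth G where
  kFinite := by
    refine FiniteDimensional.span_of_finite ℂ
      ((Set.finite_singleton (matCoeff l v : G → ℂ)).subset ?_)
    rintro _ ⟨k, rfl⟩
    refine funext fun g => ?_
    change l (smoothRep π (g * k) v) = l (smoothRep π g v)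
    rw [map_mul, Module.End.mul_apply, hv k k.2]
  zFinite := by
    refine Submodule.finiteDimensional_of_le (S₂ := Submodule.span ℂ {matCoeff l v})
      (Submodule.span_le.2 ?_)
    rintro _ ⟨u, rfl⟩
    change rAct _ (matCoeff l v) ∈ Submodule.span ℂ {matCoeff l v}
    rw [rAct_matCoeff, hπχ, matCoeff_smul]
    exact Submodule.smul_mem _ _ (Submodule.mem_span_singleton_self _)
  growth := hasGrowthBound_matCoeff hG l v

/-- If the spherical matrix coefficient of `T` vanishes and both spherical vectors are cyclic, then
`T = 0`. -/
theorem eq_zero_of_isCyclic [CompleteSpace H] [CompleteSpace H'] {v : SmoothVec π}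
    (hv : IsCyclicVector v) {ξ : SmoothVec τ →L[ℂ] ℂ} (hξ : IsCyclicForm ξ)
    {T : SmoothVec π →L[ℂ] SmoothVec τ} (hT : T ∈ SymmetryBreaking hle π τ)
    (h0 : matCoeff (ξ.comp T) v = 0) : T = 0 := by
  have h1 : ξ.comp T = 0 := form_eq_zero_of_isKFinite fun w hw => by
    obtain ⟨u, rfl⟩ := (hv w).1 hw
    have : matCoeff (ξ.comp T) (dAct π u v) = 0 := by rw [← rAct_matCoeff, h0, map_zero]
    have h2 := congrArg (fun f : SmoothFn G ℂ => (f : G → ℂ) 1) this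
    simpa [matCoeff_apply] using h2
  ext w
  refine eq_zero_of_isKFiniteForm fun η hη => ?_
  obtain ⟨u, rfl⟩ := (hξ η).1 hη
  rw [dualAct_apply, ← map_dAct hT]
  exact DFunLike.congr_fun h1 _

/-- In an irreducible representation, a continuous linear form that vanishes on the orbit of a
non-zero vector is zero: the vectors on whose orbits it vanishes form a closed invariant
subspace. -/
theorem form_eq_zero_of_isIrreducibleSmooth (hπ : IsIrreducibleSmooth π)
    {l : SmoothVec π →L[ℂ] ℂ} {v : SmoothVec π} (hv : v ≠ 0)
    (hl : ∀ g, l (smoothRep π g v) = 0) : l = 0 := by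
  let W : Submodule ℂ (SmoothVec π) :=
    ⨅ g : G, LinearMap.ker ((l : SmoothVec π →ₗ[ℂ] ℂ) ∘ₗ smoothRep π g)
  have hW : ∀ w, w ∈ W ↔ ∀ g, l (smoothRep π g w) = 0 := fun w => by
    simp [W, Submodule.mem_iInf]
  have hcl : IsClosed (W : Set (SmoothVec π)) := by
    have : (W : Set (SmoothVec π)) = ⋂ g : G, {w | l (smoothRep π g w) = 0} := by
      ext w; simp [hW]
    rw [this]
    exact isClosed_iInter fun g =>
      isClosed_eq (l.continuous.comp (continuous_smoothRep g)) continuous_const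
  rcases hπ.2 W hcl fun g w hw => (hW _).2 fun h => by
    rw [← Module.End.mul_apply, ← map_mul]; exact (hW w).1 hw _ with h | h
  · have : v ∈ W := (hW v).2 hl
    rw [h, Submodule.mem_bot] at this
    exact absurd this hv
  · ext w
    have : w ∈ W := by rw [h]; trivial
    simpa using (hW w).1 this 1

/-- If the spherical matrix coefficient of `T` vanishes and both representations are irreducible,
then `T = 0`. -/
theorem eq_zero_of_isIrreducibleSmooth (hπ : IsIrreducibleSmooth π) (hτ : IsIrreducibleSmooth τ)
    {v : SmoothVec π} (hv : v ≠ 0) {ξ : SmoothVec τ →L[ℂ] ℂ} (hξ : ξ ≠ 0)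
    {T : SmoothVec π →L[ℂ] SmoothVec τ} (hT : T ∈ SymmetryBreaking hle π τ)
    (h0 : matCoeff (ξ.comp T) v = 0) : T = 0 := by
  have h1 : ξ.comp T = 0 := form_eq_zero_of_isIrreducibleSmooth hπ hv fun g =>
    congrFun (congrArg Subtype.val h0) g
  ext w
  by_contra hw
  refine hξ (form_eq_zero_of_isIrreducibleSmooth hτ hw fun h => ?_)
  rw [← hT]
  exact DFunLike.congr_fun h1 _

end ShintaniFunctions

end Shintani

theorem proposition5p1 {n : ℕ} (G G' : LinGrp n) (hle : G' ≤ G)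
    (hG : IsRealReductive G) (hG' : IsConjRealReductive G') (hK' : IsMaximalCompactK G')
    (𝔧 : LieSubalgebra ℝ (lieAlg G)) (h𝔧 : 𝔧.IsCartanSubalgebra)
    (𝔧' : LieSubalgebra ℝ (lieAlg G')) (h𝔧' : 𝔧'.IsCartanSubalgebra)
    (lam : Module.Dual ℂ (Cplx 𝔧)) (ν : Module.Dual ℂ (Cplx 𝔧'))
    {H : Type*} [NormedAddCommGroup H] [NormedSpace ℂ H] [CompleteSpace H]
    {H' : Type*} [NormedAddCommGroup H'] [NormedSpace ℂ H'] [CompleteSpace H']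
    (π : BanachRep G H) (hπ : IsAdmissible π)
    (τ : BanachRep G' H') (hτ : IsAdmissible τ)
    (hπχ : HasInfinitesimalCharacter π (chi 𝔧 lam))
    (hτχ : HasInfinitesimalCharacter τ (chi 𝔧' (-ν)))
    (onePi : SmoothVec π) (hPi : IsSpherical onePi) (hPi0 : onePi ≠ 0)
    (oneTau : SmoothVec τ →L[ℂ] ℂ) (hTau : IsSphericalForm oneTau) (hTau0 : oneTau ≠ 0) :
    ∃ Φ : SymmetryBreaking hle π τ →ₗ[ℂ] ShMod hle lam ν,
      (∀ (T : SymmetryBreaking hle π τ) (g : G),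
        ((Φ T : SmoothFn G ℂ) : G → ℂ) g =
          oneTau ((T : SmoothVec π →L[ℂ] SmoothVec τ) (smoothRep π g onePi))) ∧
      (IsCyclicVector onePi → IsCyclicForm oneTau → Function.Injective Φ) ∧
      (IsIrreducibleSmooth π → IsIrreducibleSmooth τ → Function.Injective Φ) := by
  let Φ : SymmetryBreaking hle π τ →ₗ[ℂ] ShMod hle lam ν :=
    { toFun := fun T => ⟨matCoeff (oneTau.comp T.1) onePi,
        matCoeff_mem_sh hπχ hτχ hPi hTau T.2, matCoeff_mem_moderateGrowth hG hπχ hPi _⟩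
      map_add' := fun T₁ T₂ => Subtype.ext (by
        change matCoeff (oneTau.comp (T₁.1 + T₂.1)) onePi = _
        rw [ContinuousLinearMap.comp_add, matCoeff_add_left]
        rfl)
      map_smul' := fun c T => Subtype.ext (by
        change matCoeff (oneTau.comp (c • T.1)) onePi = _
        rw [ContinuousLinearMap.comp_smul, matCoeff_smul_left]
        rfl) }
  have hΦ : ∀ T, Φ T = 0 → matCoeff (oneTau.comp T.1) onePi = 0 := fun T h =>
    congrArg Subtype.val h
  refine ⟨Φ, fun T g => rfl, fun hc hc' => ?_, fun hi hi' => ?_⟩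
  · exact (injective_iff_map_eq_zero Φ).2 fun T h =>
      Subtype.ext (eq_zero_of_isCyclic hc hc' T.2 (hΦ T h))
  · exact (injective_iff_map_eq_zero Φ).2 fun T h =>
      Subtype.ext (eq_zero_of_isIrreducibleSmooth hi hi' hPi0 hTau0 T.2 (hΦ T h))
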